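/- All vector spaces are over $\mathbb{C}$ and $\mathbb{Z}_2$-graded; modules over a Lie superalgebra are $\mathbb{Z}_2$-graded, a module is simple if it is nonzero and has no proper nonzero graded submodule, and isomorphisms are parity-preserving. Let $\bar{\mathfrak s}$ be the Lie superalgebra with even basis $L_n$ and odd basis $G_n$ ($n\in\mathbb{Z}$) and brackets $$[L_m,L_n]=(n-m)L_{m+n},\qquad [L_m,G_p]=\left(p-\tfrac m2\right)G_{p+m},\qquad [G_p,G_q]=-2L_{p+q}$$ (the centreless $N=1$ Ramond algebra). Let $A=\mathbb{C}[t^{\pm1}]\otimes\Lambda(\xi)$ with $t$ even and $\xi$ odd ($\xi^2=0$), on which $\bar{\mathfrak s}$ acts by $$L_n\circ x=t^{n+1}\partial_t(x)+\tfrac n2t^n\xi\partial_\xi(x),\qquad G_n\circ x=t^{n+1}\xi\partial_t(x)-t^n\partial_\xi(x),$$ and let $\widetilde{\mathfrak s}=\bar{\mathfrak s}\ltimes A$, with $A$ an abelian Lie superalgebra and $[x,y]=x\circ y$ for $x\in\bar{\mathfrak s}$, $y\in A$. An $A\bar{\mathfrak s}$-module is an $\widetilde{\mathfrak s}$-module on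 which $A$ acts as a unital associative algebra. It is a weight module if $L_0$ acts diagonalizably, and its support $\mathrm{Supp}(M)$ is the set of eigenvalues of $L_0$ on $M$. The algebra $A$ also acts on $\bar{\mathfrak s}$ by $t^iL_n=L_{n+i}$, $t^iG_n=G_{n+i}$, $\xi L_n=\frac12G_n$, $\xi G_n=0$, and $(t-1)\bar{\mathfrak s}$ is a Lie subsuperalgebra of $\bar{\mathfrak s}$. For $\lambda\in\mathbb{C}$ and a $(t-1)\bar{\mathfrak s}$-module $V$, let $\Gamma(\lambda,V)$ be the $A\bar{\mathfrak s}$-module with underlying superspace $A\otimes V$, where, for homogeneous $y\in A$ and $u\in V$, \begin{align*} a\cdot(y\otimes u)&=ay\otimes u\qquad(a\in A),\\ L_m\cdot(y\otimes u)&=t^my\otimes(L_m-L_0)u-(-1)^{|y|}\tfrac m2t^m\xi y\otimes(G_m-G_0)u\\ &\quad+t^m(\lambda y+t\partial_t(y))\otimes u+\tfrac m2t^m\xi\partial_\xi(y)\otimes u,\\ G_m\cdot(y\otimes u)&=(-1)^{|y|}t^my\otimes(G_m-G_0)u+2t^m\xi y\otimes(L_m-L_0)u\\ &\quad+t^m\xi(\lambda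 y+t\partial_t(y))\otimes u-t^m\partial_\xi(y)\otimes u. \end{align*} 1. For every $\lambda\in\mathbb{C}$ and every simple $(t-1)\bar{\mathfrak s}$-module $V$, $\Gamma(\lambda,V)$ is a simple weight $A\bar{\mathfrak s}$-module. 2. Every simple weight $A\bar{\mathfrak s}$-module $M$ is isomorphic to $\Gamma(\lambda,V)$ for some $\lambda\in\mathrm{Supp}(M)$ and some simple $(t-1)\bar{\mathfrak s}$-module $V$. -/

import Mathlib

open scoped TensorProduct LaurentPolynomial

set_option linter.unusedSimpArgs false
set_option linter.unusedSectionVars false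
set_option linter.unnecessarySeqFocus false

universe u v

noncomputable section

namespace Ramond

/-! ### Superspaces, Lie superalgebras and their modules, over the complex numbers -/

/-- A vector superspace: a complex vector space with a decomposition into an even part `part 0`
and an odd part `part 1`. -/
class SuperSpace (V : Type*) [AddCommGroup V] [Module ℂ V] where
  part : ZMod 2 → Submodule ℂ V
  isCompl : IsCompl (part 0) (part 1)

/-- The sign `(-1)^(|x||y|)` for homogeneous `x`, `y` of parities `i`, `j`. -/
def koszul (i j : ZMod 2) : ℂ := (-1) ^ (i.val * j.val)

/-- A Lie superalgebra over `ℂ`. -/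
class LieSuperalgebra (L : Type*) [AddCommGroup L] [Module ℂ L] extends SuperSpace L where
  /-- the (super) bracket `[x, y]` -/
  sbr : L →ₗ[ℂ] L →ₗ[ℂ] L
  sbr_mem : ∀ (i j : ZMod 2) (x y : L), x ∈ part i → y ∈ part j → sbr x y ∈ part (i + j)
  sbr_skew : ∀ (i j : ZMod 2) (x y : L), x ∈ part i → y ∈ part j →
    sbr x y = -(koszul i j • sbr y x)
  sbr_jacobi : ∀ (i j : ZMod 2) (x y z : L), x ∈ part i → y ∈ part j →
    sbr x (sbr y z) = sbr (sbr x y) z + koszul i j • sbr y (sbr x z)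

open SuperSpace LieSuperalgebra

/-- A module over the Lie superalgebra `L` with underlying superspace `M`. -/
structure SuperRep (L : Type*) [AddCommGroup L] [Module ℂ L] [LieSuperalgebra L]
    (M : Type*) [AddCommGroup M] [Module ℂ M] [SuperSpace M] where
  act : L →ₗ[ℂ] Module.End ℂ M
  act_mem : ∀ (i j : ZMod 2) (x : L) (v : M), x ∈ part i → v ∈ part j → act x v ∈ part (i + j)
  act_sbr : ∀ (i j : ZMod 2) (x y : L), x ∈ part i → y ∈ part j →
    act (sbr x y) = act x * act y - koszul i j • (act y * act x)

namespace SuperRep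

variable {L : Type*} [AddCommGroup L] [Module ℂ L] [LieSuperalgebra L]
  {M : Type*} [AddCommGroup M] [Module ℂ M] [SuperSpace M]
  {M' : Type*} [AddCommGroup M'] [Module ℂ M'] [SuperSpace M']

/-- A (graded) submodule. -/
def IsSubmodule (ρ : SuperRep L M) (N : Submodule ℂ M) : Prop :=
  N = (N ⊓ part 0) ⊔ (N ⊓ part 1) ∧ ∀ (x : L), ∀ v ∈ N, ρ.act x v ∈ N

/-- Simplicity: a nonzero module without proper nonzero (graded) submodules. -/
def IsSimple (ρ : SuperRep L M) : Prop :=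
  Nontrivial M ∧ ∀ N : Submodule ℂ M, ρ.IsSubmodule N → N = ⊥ ∨ N = ⊤

/-- Isomorphism of modules: an even linear bijection commuting with the actions. -/
def Iso (ρ : SuperRep L M) (ρ' : SuperRep L M') : Prop :=
  ∃ e : M ≃ₗ[ℂ] M', (∀ i : ZMod 2, ∀ v ∈ part (V := M) i, e v ∈ part (V := M') i) ∧
    ∀ (x : L) (v : M), e (ρ.act x v) = ρ'.act x (e v)

end SuperRep

/-! ### Laurent polynomials and the superalgebra `A` -/

/-- The linear map on `ℂ[t, t⁻¹]` with prescribed values on the basis `t^n`. -/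
def laurentLift {W : Type*} [AddCommGroup W] [Module ℂ W] (φ : ℤ → W) : ℂ[T;T⁻¹] →ₗ[ℂ] W :=
  Finsupp.linearCombination ℂ φ ∘ₗ (AddMonoidAlgebra.coeffLinearEquiv ℂ).toLinearMap

lemma laurentLift_T {W : Type*} [AddCommGroup W] [Module ℂ W] (φ : ℤ → W) (n : ℤ) :
    laurentLift φ (LaurentPolynomial.T n) = φ n := by
  simp [laurentLift, LaurentPolynomial.T, -LaurentPolynomial.single_eq_C_mul_T]

lemma laurent_ext {W : Type*} [AddCommGroup W] [Module ℂ W] {f g : ℂ[T;T⁻¹] →ₗ[ℂ] W}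
    (h : ∀ n, f (LaurentPolynomial.T n) = g (LaurentPolynomial.T n)) : f = g := by
  ext n
  simpa [LaurentPolynomial.T, -LaurentPolynomial.single_eq_C_mul_T] using h n

/-- The derivation `t ∂_t` of `ℂ[t, t⁻¹]`, sending `t^n` to `n t^n`. -/
def euler : ℂ[T;T⁻¹] →ₗ[ℂ] ℂ[T;T⁻¹] :=
  laurentLift (fun n => (n : ℂ) • (LaurentPolynomial.T n : ℂ[T;T⁻¹]))

lemma euler_T (n : ℤ) : euler (LaurentPolynomial.T n) = (n : ℂ) • LaurentPolynomial.T n :=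
  laurentLift_T _ n

lemma euler_mul (f g : ℂ[T;T⁻¹]) : euler (f * g) = f * euler g + g * euler f := by
  have : (LinearMap.mul ℂ ℂ[T;T⁻¹]).compr₂ euler =
      (LinearMap.mul ℂ ℂ[T;T⁻¹]).compl₂ euler +
      ((LinearMap.mul ℂ ℂ[T;T⁻¹]).compl₂ euler).flip := by
    refine laurent_ext fun m => laurent_ext fun n => ?_
    simp only [LinearMap.compr₂_apply, LinearMap.add_apply, LinearMap.compl₂_apply,
      LinearMap.mul_apply', LinearMap.flip_apply, ← LaurentPolynomial.T_add, euler_T,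
      mul_smul_comm, add_comm n m]
    push_cast
    module
  simpa using LinearMap.congr_fun (LinearMap.congr_fun this f) g

lemma euler_C (c : ℂ) : euler (LaurentPolynomial.C c) = 0 := by
  have h : (LaurentPolynomial.C c : ℂ[T;T⁻¹]) = c • LaurentPolynomial.T 0 := by
    rw [LaurentPolynomial.smul_eq_C_mul, LaurentPolynomial.T_zero, mul_one]
  rw [h, map_smul, euler_T]; simp

lemma euler_two : euler 2 = 0 := by
  rw [← map_ofNat LaurentPolynomial.C 2, euler_C]

lemma euler_one : euler 1 = 0 := by
  rw [← LaurentPolynomial.T_zero, euler_T]; simp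

/-- `A = ℂ[t, t⁻¹] ⊗ Λ(1)`, realised as `ℂ[t, t⁻¹][ξ]/(ξ²)`; the element `p + q ξ` has even
component `p = fst` and odd component `q = snd`. -/
abbrev A : Type := DualNumber ℂ[T;T⁻¹]

/-- `t^n ∈ A`. -/
def tpow (n : ℤ) : A := TrivSqZeroExt.inl (LaurentPolynomial.T n)

/-- `ξ ∈ A`. -/
def xi : A := DualNumber.eps

/-- The Laurent polynomials inside `A`. -/
def emb (f : ℂ[T;T⁻¹]) : A := TrivSqZeroExt.inl f

/-- `t ∂_t` on `A`. -/
def tdt : A →ₗ[ℂ] A where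
  toFun a := TrivSqZeroExt.inl (euler a.fst) + TrivSqZeroExt.inr (euler a.snd)
  map_add' a b := by ext <;> simp
  map_smul' c a := by ext <;> simp

/-- `∂_ξ` on `A`: it sends `p + q ξ` to `q`. -/
def dxi : A →ₗ[ℂ] A where
  toFun a := TrivSqZeroExt.inl a.snd
  map_add' a b := by ext <;> simp
  map_smul' c a := by ext <;> simp

/-- The parity operator on `A`: it sends a homogeneous `y` to `(-1)^|y| y`. -/
def parA : A →ₗ[ℂ] A where
  toFun a := TrivSqZeroExt.inl a.fst - TrivSqZeroExt.inr a.snd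
  map_add' a b := by ext <;> simp; ring
  map_smul' c a := by ext <;> simp

instance : SuperSpace A where
  part i := if i = 0 then LinearMap.ker (TrivSqZeroExt.sndHom ℂ[T;T⁻¹] ℂ[T;T⁻¹] |>.restrictScalars ℂ)
    else LinearMap.ker ((TrivSqZeroExt.fstHom ℂ ℂ[T;T⁻¹] ℂ[T;T⁻¹]).toLinearMap)
  isCompl := by
    simp only [if_true, one_ne_zero, if_false]
    refine ⟨?_, ?_⟩
    · rw [Submodule.disjoint_def]
      intro a h0 h1
      ext <;> simp_all
    · rw [codisjoint_iff, eq_top_iff]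
      intro a _
      rw [← TrivSqZeroExt.inl_fst_add_inr_snd_eq a]
      exact Submodule.add_mem_sup (by simp) (by simp)

lemma mem_A_zero {a : A} : a ∈ part (V := A) 0 ↔ a.snd = 0 := by
  simp [part]

lemma mem_A_one {a : A} : a ∈ part (V := A) 1 ↔ a.fst = 0 := by
  simp [part]

/-! ### The Lie superalgebra `s̄`, the quotient of the `N = 1` Ramond algebra by its centre -/

/-- The space of `s̄`: the pair `(f, g)` stands for `f L_0 + g G_0`, where `t^n L_0 = L_n` and
`t^n G_0 = G_n`. -/
abbrev SBar : Type := ℂ[T;T⁻¹] × ℂ[T;T⁻¹]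

/-- The basis vector `L_n`. -/
def L (n : ℤ) : SBar := (LaurentPolynomial.T n, 0)

/-- The basis vector `G_n`. -/
def G (n : ℤ) : SBar := (0, LaurentPolynomial.T n)

/-- The bracket of `s̄`; on the basis it is given by `sBracket_L_L`, `sBracket_L_G`,
`sBracket_G_L`, `sBracket_G_G` below. -/
def sBracket : SBar →ₗ[ℂ] SBar →ₗ[ℂ] SBar :=
  LinearMap.mk₂ ℂ (fun x y =>
    (x.1 * euler y.1 - y.1 * euler x.1 - (2 : ℂ) • (x.2 * y.2),
     (x.1 * euler y.2 - (1 / 2 : ℂ) • (y.2 * euler x.1)) -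
     (y.1 * euler x.2 - (1 / 2 : ℂ) • (x.2 * euler y.1))))
    (fun x x' y => by ext1 <;> simp [add_mul, mul_add] <;> abel)
    (fun c x y => by ext1 <;> simp [smul_sub, smul_comm c])
    (fun x y y' => by ext1 <;> simp [add_mul, mul_add] <;> abel)
    (fun c x y => by ext1 <;> simp [smul_sub, smul_comm c])

lemma sBracket_apply (x y : SBar) : sBracket x y =
    (x.1 * euler y.1 - y.1 * euler x.1 - (2 : ℂ) • (x.2 * y.2),
     (x.1 * euler y.2 - (1 / 2 : ℂ) • (y.2 * euler x.1)) -
     (y.1 * euler x.2 - (1 / 2 : ℂ) • (x.2 * euler y.1))) := rfl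

lemma T_mul_T (m n : ℤ) : (LaurentPolynomial.T m * LaurentPolynomial.T n : ℂ[T;T⁻¹]) =
    LaurentPolynomial.T (m + n) := (LaurentPolynomial.T_add m n).symm

lemma sBracket_L_L (m n : ℤ) : sBracket (L m) (L n) = ((n : ℂ) - m) • L (m + n) := by
  simp only [sBracket_apply, L, euler_T, mul_smul_comm, T_mul_T, add_comm n m, map_zero, mul_zero,
    zero_mul, smul_zero, sub_zero, Prod.smul_mk, sub_smul, Prod.mk_sub_mk]

lemma sBracket_L_G (m p : ℤ) : sBracket (L m) (G p) = ((p : ℂ) - m / 2) • G (p + m) := by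
  simp only [sBracket_apply, L, G, euler_T, mul_smul_comm, T_mul_T, add_comm p m, map_zero,
    mul_zero, zero_mul, smul_zero, sub_zero, Prod.smul_mk, sub_smul, smul_smul, Prod.mk_sub_mk]
  rw [one_div_mul_eq_div]

lemma sBracket_G_L (p m : ℤ) : sBracket (G p) (L m) = -(((p : ℂ) - m / 2) • G (p + m)) := by
  simp only [sBracket_apply, L, G, euler_T, mul_smul_comm, T_mul_T, add_comm p m, map_zero,
    mul_zero, zero_mul, smul_zero, sub_zero, zero_sub, Prod.smul_mk, sub_smul, smul_smul,
    Prod.mk_sub_mk, Prod.neg_mk, neg_zero, neg_sub]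
  rw [one_div_mul_eq_div]

lemma sBracket_G_G (p q : ℤ) : sBracket (G p) (G q) = (-2 : ℂ) • L (p + q) := by
  simp only [sBracket_apply, L, G, T_mul_T, map_zero, mul_zero, zero_mul, smul_zero, sub_zero,
    zero_sub, Prod.smul_mk, neg_smul, Prod.neg_mk, neg_zero]

lemma parity_cases (i : ZMod 2) : i = 0 ∨ i = 1 := by
  revert i; decide

lemma koszul_zero_left (i : ZMod 2) : koszul 0 i = 1 := by simp [koszul]

lemma koszul_zero_right (i : ZMod 2) : koszul i 0 = 1 := by simp [koszul]

lemma koszul_one_one : koszul 1 1 = -1 := by simp [koszul, ZMod.val_one]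

lemma one_add_one_parity : (1 + 1 : ZMod 2) = 0 := by decide

/-- The even part of `s̄` is spanned by the `L_n`, the odd part by the `G_n`. -/
instance : SuperSpace SBar where
  part i := if i = 0 then LinearMap.ker (LinearMap.snd ℂ ℂ[T;T⁻¹] ℂ[T;T⁻¹])
    else LinearMap.ker (LinearMap.fst ℂ ℂ[T;T⁻¹] ℂ[T;T⁻¹])
  isCompl := by
    simpa [LinearMap.range_inl, LinearMap.range_inr] using
      (LinearMap.isCompl_range_inl_inr (R := ℂ) (M := ℂ[T;T⁻¹]) (M₂ := ℂ[T;T⁻¹]))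

lemma mem_S_zero {x : SBar} : x ∈ part (V := SBar) 0 ↔ x.2 = 0 := by
  simp [part]

lemma mem_S_one {x : SBar} : x ∈ part (V := SBar) 1 ↔ x.1 = 0 := by
  simp [part]

lemma smul_half_aux (c : ℂ) (f : ℂ[T;T⁻¹]) : c • f = LaurentPolynomial.C c * f :=
  LaurentPolynomial.smul_eq_C_mul c f

instance : LieSuperalgebra SBar where
  sbr := sBracket
  sbr_mem i j x y hx hy := by
    obtain rfl | rfl := parity_cases i <;> obtain rfl | rfl := parity_cases j <;>
    simp only [mem_S_zero, mem_S_one, add_zero, zero_add, one_add_one_parity, sBracket_apply]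
      at hx hy ⊢ <;> simp [hx, hy]
  sbr_skew i j x y hx hy := by
    obtain rfl | rfl := parity_cases i <;> obtain rfl | rfl := parity_cases j <;>
    simp only [mem_S_zero, mem_S_one, koszul_zero_left, koszul_zero_right, koszul_one_one]
      at hx hy ⊢ <;> ext1 <;> simp [sBracket_apply, hx, hy, mul_comm]
  sbr_jacobi i j x y z hx hy := by
    obtain ⟨x1, x2⟩ := x
    obtain ⟨y1, y2⟩ := y
    obtain ⟨z1, z2⟩ := z
    have hC : (LaurentPolynomial.C (1 / 2 : ℂ)) * 2 = 1 := by
      rw [← map_ofNat LaurentPolynomial.C 2, ← map_mul]; simp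
    have hC2 : (LaurentPolynomial.C (2 : ℂ)) = 2 := map_ofNat LaurentPolynomial.C 2
    obtain rfl | rfl := parity_cases i <;> obtain rfl | rfl := parity_cases j <;>
    simp only [mem_S_zero, mem_S_one, koszul_zero_left, koszul_zero_right, koszul_one_one]
      at hx hy ⊢ <;> subst hx <;> subst hy <;>
    simp only [sBracket_apply, map_sub, map_smul, euler_mul, map_zero, mul_zero, zero_mul,
      smul_zero, sub_zero, zero_sub] <;>
    (ext1 <;> simp [smul_half_aux, hC2, euler_mul, euler_C, euler_two] <;> grind)

/-- The action `x ∘ a` of `s̄` on `A`; on the basis it is `L_n ∘ a = t^n (t∂_t a) + (n/2) t^n ξ ∂_ξ a`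
and `G_n ∘ a = t^n ξ (t∂_t a) - t^n ∂_ξ a`, see `actA_L` and `actA_G`. -/
def actA : SBar →ₗ[ℂ] A →ₗ[ℂ] A :=
  LinearMap.mk₂ ℂ (fun x a =>
      emb x.1 * tdt a + (1 / 2 : ℂ) • (emb (euler x.1) * (xi * dxi a)) +
      (emb x.2 * (xi * tdt a) - emb x.2 * dxi a))
    (fun x x' y => by ext <;> simp [emb, xi, tdt, dxi, add_mul, mul_add] <;> abel)
    (fun c x y => by ext <;> simp [emb, xi, tdt, dxi, smul_add, smul_comm c])
    (fun x y y' => by ext <;> simp [emb, xi, tdt, dxi, add_mul, mul_add] <;> abel)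
    (fun c x y => by ext <;> simp [emb, xi, tdt, dxi, smul_add, smul_comm c])

lemma actA_apply (x : SBar) (a : A) : actA x a =
    emb x.1 * tdt a + (1 / 2 : ℂ) • (emb (euler x.1) * (xi * dxi a)) +
      (emb x.2 * (xi * tdt a) - emb x.2 * dxi a) := rfl

lemma actA_L (n : ℤ) (a : A) :
    actA (L n) a = tpow n * tdt a + ((n : ℂ) / 2) • (tpow n * (xi * dxi a)) := by
  refine TrivSqZeroExt.ext ?_ ?_ <;>
    simp [actA_apply, L, emb, tpow, euler_T, xi, tdt, dxi, smul_smul, div_eq_inv_mul]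

lemma actA_G (n : ℤ) (a : A) :
    actA (G n) a = tpow n * (xi * tdt a) - tpow n * dxi a := by
  ext <;> simp [actA_apply, G, emb, tpow]

lemma fst_actA (x : SBar) (a : A) : (actA x a).fst = x.1 * euler a.fst - x.2 * a.snd := by
  simp [actA_apply, emb, xi, tdt, dxi, sub_eq_add_neg]

lemma snd_actA (x : SBar) (a : A) : (actA x a).snd =
    x.1 * euler a.snd + (1 / 2 : ℂ) • (euler x.1 * a.snd) + x.2 * euler a.fst := by
  simp [actA_apply, emb, xi, tdt, dxi]

/-! ### The semidirect product `s̃ = s̄ ⋉ A` -/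

/-- The space of `s̃ = s̄ ⋉ A`. -/
abbrev STilde : Type := SBar × A

/-- The projection of `s̄` onto its even part. -/
def evenS : SBar →ₗ[ℂ] SBar := LinearMap.inl ℂ _ _ ∘ₗ LinearMap.fst ℂ _ _

/-- The projection of `s̄` onto its odd part. -/
def oddS : SBar →ₗ[ℂ] SBar := LinearMap.inr ℂ _ _ ∘ₗ LinearMap.snd ℂ _ _

/-- The bracket of `s̃`: `[x, b] = x ∘ b` and `[b, x] = -(-1)^(|x||b|) x ∘ b` for `x ∈ s̄`, `b ∈ A`,
and `[A, A] = 0`. -/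
def stBracket : STilde →ₗ[ℂ] STilde →ₗ[ℂ] STilde :=
  LinearMap.mk₂ ℂ (fun X Y =>
      (sBracket X.1 Y.1,
       actA X.1 Y.2 - actA (evenS Y.1) X.2 - actA (oddS Y.1) (parA X.2)))
    (fun x x' y => by
      refine Prod.ext ?_ ?_
      · simp
      · simp only [map_add, LinearMap.add_apply, Prod.snd_add, Prod.fst_add]; abel)
    (fun c x y => by
      refine Prod.ext ?_ ?_
      · simp
      · simp only [map_smul, LinearMap.smul_apply, Prod.smul_snd, Prod.smul_fst, smul_sub])
    (fun x y y' => by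
      refine Prod.ext ?_ ?_
      · simp
      · simp only [map_add, LinearMap.add_apply, Prod.snd_add, Prod.fst_add]; abel)
    (fun c x y => by
      refine Prod.ext ?_ ?_
      · simp
      · simp only [map_smul, LinearMap.smul_apply, Prod.smul_snd, Prod.smul_fst, smul_sub])

lemma stBracket_apply (X Y : STilde) : stBracket X Y =
    (sBracket X.1 Y.1, actA X.1 Y.2 - actA (Y.1.1, 0) X.2 - actA (0, Y.1.2) (parA X.2)) := rfl

instance : SuperSpace STilde where
  part i := (part (V := SBar) i).prod (part (V := A) i)
  isCompl := by
    have h := SuperSpace.isCompl (V := SBar)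
    have h' := SuperSpace.isCompl (V := A)
    refine ⟨?_, ?_⟩
    · rw [disjoint_iff, Submodule.prod_inf_prod, h.inf_eq_bot, h'.inf_eq_bot, Submodule.prod_bot]
    · rw [codisjoint_iff, Submodule.prod_sup_prod, h.sup_eq_top, h'.sup_eq_top, Submodule.prod_top]

lemma mem_St {i : ZMod 2} {X : STilde} :
    X ∈ part (V := STilde) i ↔ X.1 ∈ part (V := SBar) i ∧ X.2 ∈ part (V := A) i := Iff.rfl

lemma fst_parA (a : A) : (parA a).fst = a.fst := by simp [parA]

lemma snd_parA (a : A) : (parA a).snd = -a.snd := by simp [parA]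

instance : LieSuperalgebra STilde where
  sbr := stBracket
  sbr_mem i j X Y hX hY := by
    obtain ⟨⟨x1, x2⟩, a⟩ := X
    obtain ⟨⟨y1, y2⟩, b⟩ := Y
    obtain rfl | rfl := parity_cases i <;> obtain rfl | rfl := parity_cases j <;>
    simp only [mem_St, mem_S_zero, mem_S_one, mem_A_zero, mem_A_one, add_zero, zero_add,
      one_add_one_parity, sBracket_apply, stBracket_apply] at hX hY ⊢ <;>
    simp [hX, hY, fst_actA, snd_actA, fst_parA, snd_parA]
  sbr_skew i j X Y hX hY := by
    obtain ⟨⟨x1, x2⟩, a⟩ := X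
    obtain ⟨⟨y1, y2⟩, b⟩ := Y
    obtain rfl | rfl := parity_cases i <;> obtain rfl | rfl := parity_cases j <;>
    simp only [mem_St, mem_S_zero, mem_S_one, mem_A_zero, mem_A_one, koszul_zero_left,
      koszul_zero_right, koszul_one_one] at hX hY ⊢ <;>
    obtain ⟨rfl, hX⟩ := hX <;> obtain ⟨rfl, hY⟩ := hY <;>
    (refine Prod.ext (Prod.ext ?_ ?_) (TrivSqZeroExt.ext ?_ ?_)) <;>
    simp [sBracket_apply, stBracket_apply, hX, hY, mul_comm, fst_actA, snd_actA, fst_parA,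
      snd_parA] <;> abel
  sbr_jacobi i j X Y Z hX hY := by
    obtain ⟨⟨x1, x2⟩, a⟩ := X
    obtain ⟨⟨y1, y2⟩, b⟩ := Y
    obtain ⟨⟨z1, z2⟩, c⟩ := Z
    have hC : (LaurentPolynomial.C (1 / 2 : ℂ)) * 2 = 1 := by
      rw [← map_ofNat LaurentPolynomial.C 2, ← map_mul]; simp
    have hC2 : (LaurentPolynomial.C (2 : ℂ)) = 2 := map_ofNat LaurentPolynomial.C 2
    have hjac := LieSuperalgebra.sbr_jacobi (L := SBar) i j (x1, x2) (y1, y2) (z1, z2) hX.1 hY.1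
    refine Prod.ext hjac ?_
    clear hjac
    obtain rfl | rfl := parity_cases i <;> obtain rfl | rfl := parity_cases j <;>
    simp only [mem_St, mem_S_zero, mem_S_one, mem_A_zero, mem_A_one, koszul_zero_left,
      koszul_zero_right, koszul_one_one] at hX hY ⊢ <;>
    obtain ⟨rfl, hX⟩ := hX <;> obtain ⟨rfl, hY⟩ := hY <;>
    (refine TrivSqZeroExt.ext ?_ ?_
     · simp [stBracket_apply, sBracket_apply, fst_actA, snd_actA, fst_parA, snd_parA, hX, hY,
         smul_half_aux, hC2, euler_mul, euler_C, euler_two]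
       try grind
     · simp [stBracket_apply, sBracket_apply, fst_actA, snd_actA, fst_parA, snd_parA, hX, hY,
         smul_half_aux, hC2, euler_mul, euler_C, euler_two]
       try grind)

/-! ### The subalgebra `(t - 1) s̄` -/

/-- The `A`-module structure of `s̄`: `t^i L_n = L_(n+i)`, `t^i G_n = G_(n+i)`, `ξ L_n = G_n / 2`,
`ξ G_n = 0`. -/
def aSmul (a : A) : SBar →ₗ[ℂ] SBar where
  toFun x := (a.fst * x.1, a.fst * x.2 + (1 / 2 : ℂ) • (a.snd * x.1))
  map_add' x y := by ext1 <;> simp [mul_add]; abel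
  map_smul' c x := by ext1 <;> simp [smul_comm c]

/-- The subspace `(t - 1) s̄` of `s̄`. -/
def tSub : Submodule ℂ SBar := LinearMap.range (aSmul (tpow 1 - 1))

lemma mem_tSub {x : SBar} : x ∈ tSub ↔
    ((LaurentPolynomial.T 1 - 1 : ℂ[T;T⁻¹]) ∣ x.1) ∧ ((LaurentPolynomial.T 1 - 1 : ℂ[T;T⁻¹]) ∣ x.2) := by
  constructor
  · rintro ⟨y, rfl⟩
    simp [aSmul, tpow]
  · rintro ⟨⟨f, hf⟩, ⟨g, hg⟩⟩
    refine ⟨(f, g), ?_⟩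
    ext1 <;> simp [aSmul, tpow, hf, hg]

lemma sBracket_mem_tSub {x y : SBar} (hx : x ∈ tSub) (hy : y ∈ tSub) : sBracket x y ∈ tSub := by
  rw [mem_tSub] at *
  obtain ⟨⟨f, hf⟩, ⟨g, hg⟩⟩ := hx
  obtain ⟨⟨f', hf'⟩, ⟨g', hg'⟩⟩ := hy
  constructor
  · simp only [sBracket_apply, hf, hg, hf', hg', smul_half_aux]
    refine dvd_sub (dvd_sub ?_ ?_) ?_
    · exact Dvd.intro _ (mul_assoc _ _ _).symm
    · exact Dvd.intro _ (mul_assoc _ _ _).symm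
    · rw [mul_assoc, mul_left_comm]; exact Dvd.intro _ rfl
  · simp only [sBracket_apply, hf, hg, hf', hg', smul_half_aux]
    refine dvd_sub (dvd_sub ?_ ?_) (dvd_sub ?_ ?_)
    · exact Dvd.intro _ (mul_assoc _ _ _).symm
    · rw [mul_assoc, mul_left_comm]; exact Dvd.intro _ rfl
    · exact Dvd.intro _ (mul_assoc _ _ _).symm
    · rw [mul_assoc, mul_left_comm]; exact Dvd.intro _ rfl

instance : SuperSpace tSub where
  part i := (part (V := SBar) i).comap tSub.subtype
  isCompl := by
    refine ⟨?_, ?_⟩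
    · rw [Submodule.disjoint_def]
      rintro ⟨x, hx⟩ h0 h1
      simp only [Submodule.mem_comap, Submodule.subtype_apply, mem_S_zero, mem_S_one] at h0 h1
      exact Subtype.ext (Prod.ext h1 h0)
    · rw [codisjoint_iff, eq_top_iff]
      rintro ⟨⟨f, g⟩, hx⟩ -
      have h := mem_tSub.1 hx
      have e : (⟨(f, g), hx⟩ : tSub) = ⟨(f, 0), mem_tSub.2 ⟨h.1, dvd_zero _⟩⟩ +
        ⟨(0, g), mem_tSub.2 ⟨dvd_zero _, h.2⟩⟩ := by simp
      rw [e]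
      exact Submodule.add_mem_sup (by simp [mem_S_zero]) (by simp [mem_S_one])

/-- `(t - 1) s̄` as a Lie superalgebra, with the bracket and the parity of `s̄`. -/
instance : LieSuperalgebra tSub where
  sbr := LinearMap.mk₂ ℂ (fun x y => ⟨sBracket x y, sBracket_mem_tSub x.2 y.2⟩)
    (fun x x' y => Subtype.ext (by simp)) (fun c x y => Subtype.ext (by simp))
    (fun x y y' => Subtype.ext (by simp)) (fun c x y => Subtype.ext (by simp))
  sbr_mem i j x y hx hy := LieSuperalgebra.sbr_mem (L := SBar) i j x y hx hy
  sbr_skew i j x y hx hy := Subtype.ext (LieSuperalgebra.sbr_skew (L := SBar) i j x y hx hy)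
  sbr_jacobi i j x y z hx hy :=
    Subtype.ext (LieSuperalgebra.sbr_jacobi (L := SBar) i j x y z hx hy)

/-! ### Tensor products of superspaces -/

lemma exists_parity (V : Type*) [AddCommGroup V] [Module ℂ V] [SuperSpace V] :
    ∃ P : V →ₗ[ℂ] V, (∀ v ∈ part (V := V) 0, P v = v) ∧ (∀ v ∈ part (V := V) 1, P v = -v) := by
  refine ⟨LinearMap.ofIsCompl (SuperSpace.isCompl (V := V)) (Submodule.subtype _)
    (-Submodule.subtype _), fun v hv => ?_, fun v hv => ?_⟩
  · exact LinearMap.ofIsCompl_apply_left (SuperSpace.isCompl (V := V)) ⟨v, hv⟩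
  · exact LinearMap.ofIsCompl_apply_right (SuperSpace.isCompl (V := V)) ⟨v, hv⟩

/-- `(V ⊗ W)_k` is the sum of the `V_i ⊗ W_j` with `i + j = k`. -/
def tensorPart (V W : Type*) [AddCommGroup V] [Module ℂ V] [SuperSpace V]
    [AddCommGroup W] [Module ℂ W] [SuperSpace W] (k : ZMod 2) : Submodule ℂ (V ⊗[ℂ] W) :=
  ⨆ i : ZMod 2, Submodule.map₂ (TensorProduct.mk ℂ V W) (part i) (part (k - i))

section

variable {V W : Type*} [AddCommGroup V] [Module ℂ V] [SuperSpace V]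
    [AddCommGroup W] [Module ℂ W] [SuperSpace W]

lemma tmul_mem_tensorPart {i j k : ZMod 2} {v : V} {w : W} (hv : v ∈ part i) (hw : w ∈ part j)
    (h : i + j = k) : v ⊗ₜ[ℂ] w ∈ tensorPart V W k := by
  obtain rfl : j = k - i := by rw [← h]; abel
  exact Submodule.mem_iSup_of_mem i (Submodule.apply_mem_map₂ _ hv hw)

lemma tensorPart_le {k : ZMod 2} {N : Submodule ℂ (V ⊗[ℂ] W)}
    (h : ∀ i j : ZMod 2, i + j = k → ∀ v ∈ part (V := V) i, ∀ w ∈ part (V := W) j,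
      v ⊗ₜ[ℂ] w ∈ N) : tensorPart V W k ≤ N :=
  iSup_le fun i => Submodule.map₂_le.2 fun v hv w hw => h i (k - i) (by abel) v hv w hw

lemma exists_add_of_superSpace (v : V) : ∃ v0 ∈ part (V := V) 0, ∃ v1 ∈ part (V := V) 1,
    v0 + v1 = v := by
  have : v ∈ part (V := V) 0 ⊔ part 1 := by
    rw [(SuperSpace.isCompl (V := V)).sup_eq_top]; trivial
  exact Submodule.mem_sup.1 this

instance : SuperSpace (V ⊗[ℂ] W) where
  part := tensorPart V W
  isCompl := by
    obtain ⟨P, hP0, hP1⟩ := exists_parity V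
    obtain ⟨Q, hQ0, hQ1⟩ := exists_parity W
    refine ⟨?_, ?_⟩
    · have h0 : tensorPart V W 0 ≤ LinearMap.ker (TensorProduct.map P Q - LinearMap.id) := by
        refine tensorPart_le fun i j hij v hv w hw => ?_
        obtain rfl | rfl := parity_cases i <;> obtain rfl | rfl := parity_cases j
        · simp [hP0 v hv, hQ0 w hw]
        · simp at hij
        · simp at hij
        · simp [hP1 v hv, hQ1 w hw, TensorProduct.neg_tmul, TensorProduct.tmul_neg]
      have h1 : tensorPart V W 1 ≤ LinearMap.ker (TensorProduct.map P Q + LinearMap.id) := by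
        refine tensorPart_le fun i j hij v hv w hw => ?_
        obtain rfl | rfl := parity_cases i <;> obtain rfl | rfl := parity_cases j
        · simp at hij
        · simp [hP0 v hv, hQ1 w hw, TensorProduct.tmul_neg]
        · simp [hP1 v hv, hQ0 w hw, TensorProduct.neg_tmul]
        · simp [one_add_one_parity] at hij
      rw [Submodule.disjoint_def]
      intro x hx0 hx1
      have e0 := h0 hx0
      have e1 := h1 hx1
      simp only [LinearMap.mem_ker, LinearMap.sub_apply, LinearMap.add_apply,
        LinearMap.id_apply] at e0 e1
      rw [sub_eq_zero.1 e0, ← two_smul ℂ x] at e1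
      simpa using e1
    · rw [codisjoint_iff, eq_top_iff]
      rintro x -
      induction x with
      | zero => exact zero_mem _
      | add x y hx hy => exact add_mem hx hy
      | tmul v w =>
        obtain ⟨v0, hv0, v1, hv1, rfl⟩ := exists_add_of_superSpace v
        obtain ⟨w0, hw0, w1, hw1, rfl⟩ := exists_add_of_superSpace w
        rw [TensorProduct.add_tmul, TensorProduct.tmul_add, TensorProduct.tmul_add]
        refine add_mem (add_mem ?_ ?_) (add_mem ?_ ?_)
        · exact Submodule.mem_sup_left (tmul_mem_tensorPart hv0 hw0 (by decide))
        · exact Submodule.mem_sup_right (tmul_mem_tensorPart hv0 hw1 (by decide))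
        · exact Submodule.mem_sup_right (tmul_mem_tensorPart hv1 hw0 (by decide))
        · exact Submodule.mem_sup_left (tmul_mem_tensorPart hv1 hw1 (by decide))

end

/-! ### The modules `Γ(λ, V)` -/

lemma T_sub_one_dvd (n : ℤ) :
    (LaurentPolynomial.T 1 - 1 : ℂ[T;T⁻¹]) ∣ LaurentPolynomial.T n - 1 := by
  have key (k : ℕ) : (LaurentPolynomial.T 1 - 1 : ℂ[T;T⁻¹]) ∣ LaurentPolynomial.T k - 1 := by
    simpa [LaurentPolynomial.T_pow] using sub_dvd_pow_sub_pow (LaurentPolynomial.T 1 : ℂ[T;T⁻¹]) 1 k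
  obtain ⟨k, rfl | rfl⟩ := n.eq_nat_or_neg
  · exact key k
  · have : (LaurentPolynomial.T (-k) - 1 : ℂ[T;T⁻¹]) =
        (LaurentPolynomial.T k - 1) * (-LaurentPolynomial.T (-k)) := by
      rw [sub_mul, mul_neg, T_mul_T]; simp [LaurentPolynomial.T_zero]; ring
    rw [this]
    exact (key k).mul_right _

/-- `L_m - L_0 ∈ (t - 1) s̄`. -/
def Xs (m : ℤ) : tSub := ⟨L m - L 0, by
  rw [mem_tSub]; simpa [L] using T_sub_one_dvd m⟩

/-- `G_m - G_0 ∈ (t - 1) s̄`. -/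
def Ys (m : ℤ) : tSub := ⟨G m - G 0, by
  rw [mem_tSub]; simpa [G] using T_sub_one_dvd m⟩

section Gamma

variable {V : Type*} [AddCommGroup V] [Module ℂ V] [SuperSpace V]

/-- The operator of `L_m` on `Γ(λ, V) = A ⊗ V`:
`L_m (y ⊗ u) = t^m y ⊗ (L_m - L_0) u - (-1)^|y| (m/2) t^m ξ y ⊗ (G_m - G_0) u`
`+ t^m (λ y + t∂_t y) ⊗ u + (m/2) t^m ξ ∂_ξ y ⊗ u`. -/
def gammaL (lam : ℂ) (σ : SuperRep tSub V) (m : ℤ) : Module.End ℂ (A ⊗[ℂ] V) :=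
  TensorProduct.map (LinearMap.mulLeft ℂ (tpow m)) (σ.act (Xs m))
  - ((m : ℂ) / 2) • TensorProduct.map (LinearMap.mulLeft ℂ (tpow m * xi) ∘ₗ parA) (σ.act (Ys m))
  + TensorProduct.map (LinearMap.mulLeft ℂ (tpow m) ∘ₗ (lam • LinearMap.id + tdt)) LinearMap.id
  + ((m : ℂ) / 2) • TensorProduct.map (LinearMap.mulLeft ℂ (tpow m * xi) ∘ₗ dxi) LinearMap.id

/-- The operator of `G_m` on `Γ(λ, V) = A ⊗ V`:
`G_m (y ⊗ u) = (-1)^|y| t^m y ⊗ (G_m - G_0) u + 2 t^m ξ y ⊗ (L_m - L_0) u`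
`+ t^m ξ (λ y + t∂_t y) ⊗ u - t^m ∂_ξ y ⊗ u`. -/
def gammaG (lam : ℂ) (σ : SuperRep tSub V) (m : ℤ) : Module.End ℂ (A ⊗[ℂ] V) :=
  TensorProduct.map (LinearMap.mulLeft ℂ (tpow m) ∘ₗ parA) (σ.act (Ys m))
  + (2 : ℂ) • TensorProduct.map (LinearMap.mulLeft ℂ (tpow m * xi)) (σ.act (Xs m))
  + TensorProduct.map (LinearMap.mulLeft ℂ (tpow m * xi) ∘ₗ (lam • LinearMap.id + tdt))
      LinearMap.id
  - TensorProduct.map (LinearMap.mulLeft ℂ (tpow m) ∘ₗ dxi) LinearMap.id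

/-- The action of `s̃ = s̄ ⋉ A` on `A ⊗ V`: `L_m`, `G_m` act by `gammaL`, `gammaG`, and `A` acts by
multiplication on the first factor. -/
def gammaAct (lam : ℂ) (σ : SuperRep tSub V) : STilde →ₗ[ℂ] Module.End ℂ (A ⊗[ℂ] V) :=
  laurentLift (gammaL lam σ) ∘ₗ LinearMap.fst ℂ _ _ ∘ₗ LinearMap.fst ℂ _ _
  + laurentLift (gammaG lam σ) ∘ₗ LinearMap.snd ℂ _ _ ∘ₗ LinearMap.fst ℂ _ _
  + LinearMap.rTensorHom V ∘ₗ LinearMap.mul ℂ A ∘ₗ LinearMap.snd ℂ _ _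

lemma gammaAct_L (lam : ℂ) (σ : SuperRep tSub V) (m : ℤ) :
    gammaAct lam σ (L m, 0) = gammaL lam σ m := by
  simp [gammaAct, L, laurentLift_T]

lemma gammaAct_G (lam : ℂ) (σ : SuperRep tSub V) (m : ℤ) :
    gammaAct lam σ (G m, 0) = gammaG lam σ m := by
  simp [gammaAct, G, laurentLift_T]

lemma gammaAct_A (lam : ℂ) (σ : SuperRep tSub V) (a : A) :
    gammaAct lam σ (0, a) = LinearMap.rTensor V (LinearMap.mulLeft ℂ a) := by
  simp only [gammaAct, LinearMap.add_apply, LinearMap.comp_apply, LinearMap.fst_apply,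
    LinearMap.snd_apply, Prod.fst_zero, Prod.snd_zero, map_zero, zero_add]
  rfl

/-- `t^k ξ ∈ A`. -/
def opow (k : ℤ) : A := tpow k * xi

lemma tpow_mul_xi (k : ℤ) : tpow k * xi = opow k := rfl

lemma opow_eq (k : ℤ) : opow k = TrivSqZeroExt.inr (LaurentPolynomial.T k) := by
  refine TrivSqZeroExt.ext ?_ ?_ <;> simp [opow, tpow, xi]

lemma tpow_mul_tpow (m k : ℤ) : tpow m * tpow k = tpow (m + k) := by
  rw [tpow, tpow, ← TrivSqZeroExt.inl_mul, T_mul_T, tpow]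

lemma tpow_mul_opow (m k : ℤ) : tpow m * opow k = opow (m + k) := by
  rw [opow, ← mul_assoc, tpow_mul_tpow, opow]

lemma opow_mul_tpow (m k : ℤ) : opow m * tpow k = opow (m + k) := by
  rw [mul_comm, tpow_mul_opow, add_comm]

lemma opow_mul_opow (m k : ℤ) : opow m * opow k = 0 := by
  simp [opow_eq]

lemma tdt_tpow (k : ℤ) : tdt (tpow k) = (k : ℂ) • tpow k := by
  refine TrivSqZeroExt.ext ?_ ?_ <;> simp [tpow, tdt, euler_T]

lemma tdt_opow (k : ℤ) : tdt (opow k) = (k : ℂ) • opow k := by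
  refine TrivSqZeroExt.ext ?_ ?_ <;> simp [opow_eq, tdt, euler_T]

lemma dxi_tpow (k : ℤ) : dxi (tpow k) = 0 := by
  refine TrivSqZeroExt.ext ?_ ?_ <;> simp [tpow, dxi]

lemma dxi_opow (k : ℤ) : dxi (opow k) = tpow k := by
  refine TrivSqZeroExt.ext ?_ ?_ <;> simp [opow_eq, dxi, tpow]

lemma parA_tpow (k : ℤ) : parA (tpow k) = tpow k := by
  refine TrivSqZeroExt.ext ?_ ?_ <;> simp [tpow, parA]

lemma parA_opow (k : ℤ) : parA (opow k) = -opow k := by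
  refine TrivSqZeroExt.ext ?_ ?_ <;> simp [opow_eq, parA]

lemma gammaL_tpow (lam : ℂ) (σ : SuperRep tSub V) (m k : ℤ) (u : V) :
    gammaL lam σ m (tpow k ⊗ₜ u) = tpow (m + k) ⊗ₜ (σ.act (Xs m) u) -
      ((m : ℂ) / 2) • (opow (m + k) ⊗ₜ (σ.act (Ys m) u)) + (lam + k) • (tpow (m + k) ⊗ₜ u) := by
  simp only [gammaL, LinearMap.add_apply, LinearMap.sub_apply, LinearMap.smul_apply,
    TensorProduct.map_tmul, LinearMap.comp_apply, LinearMap.mulLeft_apply, LinearMap.id_apply,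
    parA_tpow, tdt_tpow, dxi_tpow, mul_zero, TensorProduct.zero_tmul, smul_zero, add_zero,
    tpow_mul_xi, tpow_mul_tpow, opow_mul_tpow, mul_add, mul_smul_comm, TensorProduct.add_tmul,
    TensorProduct.smul_tmul', add_smul]

lemma gammaL_opow (lam : ℂ) (σ : SuperRep tSub V) (m k : ℤ) (u : V) :
    gammaL lam σ m (opow k ⊗ₜ u) = opow (m + k) ⊗ₜ (σ.act (Xs m) u) +
      (lam + k + m / 2) • (opow (m + k) ⊗ₜ u) := by
  simp only [gammaL, LinearMap.add_apply, LinearMap.sub_apply, LinearMap.smul_apply,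
    TensorProduct.map_tmul, LinearMap.comp_apply, LinearMap.mulLeft_apply, LinearMap.id_apply,
    parA_opow, tdt_opow, dxi_opow, mul_zero, mul_neg, neg_zero, TensorProduct.zero_tmul, smul_zero,
    add_zero, sub_zero, tpow_mul_xi, tpow_mul_opow, opow_mul_tpow, opow_mul_opow, mul_add,
    mul_smul_comm, TensorProduct.add_tmul, TensorProduct.smul_tmul', add_smul, add_assoc]

lemma gammaG_tpow (lam : ℂ) (σ : SuperRep tSub V) (m k : ℤ) (u : V) :
    gammaG lam σ m (tpow k ⊗ₜ u) = tpow (m + k) ⊗ₜ (σ.act (Ys m) u) +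
      (2 : ℂ) • (opow (m + k) ⊗ₜ (σ.act (Xs m) u)) + (lam + k) • (opow (m + k) ⊗ₜ u) := by
  simp only [gammaG, LinearMap.add_apply, LinearMap.sub_apply, LinearMap.smul_apply,
    TensorProduct.map_tmul, LinearMap.comp_apply, LinearMap.mulLeft_apply, LinearMap.id_apply,
    parA_tpow, tdt_tpow, dxi_tpow, mul_zero, TensorProduct.zero_tmul, sub_zero,
    tpow_mul_xi, tpow_mul_tpow, opow_mul_tpow, mul_add, mul_smul_comm, TensorProduct.add_tmul,
    TensorProduct.smul_tmul', add_smul]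

lemma gammaG_opow (lam : ℂ) (σ : SuperRep tSub V) (m k : ℤ) (u : V) :
    gammaG lam σ m (opow k ⊗ₜ u) = -(opow (m + k) ⊗ₜ (σ.act (Ys m) u)) - tpow (m + k) ⊗ₜ u := by
  simp only [gammaG, LinearMap.add_apply, LinearMap.sub_apply, LinearMap.smul_apply,
    TensorProduct.map_tmul, LinearMap.comp_apply, LinearMap.mulLeft_apply, LinearMap.id_apply,
    parA_opow, tdt_opow, dxi_opow, mul_neg, TensorProduct.zero_tmul, smul_zero,
    add_zero, tpow_mul_xi, tpow_mul_opow, tpow_mul_tpow, opow_mul_opow, mul_add,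
    mul_smul_comm, TensorProduct.neg_tmul]

lemma A_ext {W : Type*} [AddCommGroup W] [Module ℂ W] {f g : A →ₗ[ℂ] W}
    (h0 : ∀ k, f (tpow k) = g (tpow k)) (h1 : ∀ k, f (opow k) = g (opow k)) : f = g := by
  have e0 : f ∘ₗ (TrivSqZeroExt.inlAlgHom ℂ ℂ[T;T⁻¹] ℂ[T;T⁻¹]).toLinearMap =
      g ∘ₗ (TrivSqZeroExt.inlAlgHom ℂ ℂ[T;T⁻¹] ℂ[T;T⁻¹]).toLinearMap := laurent_ext h0
  have e1 : f ∘ₗ (TrivSqZeroExt.inrHom ℂ[T;T⁻¹] ℂ[T;T⁻¹]).restrictScalars ℂ =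
      g ∘ₗ (TrivSqZeroExt.inrHom ℂ[T;T⁻¹] ℂ[T;T⁻¹]).restrictScalars ℂ :=
    laurent_ext fun k => by simpa [opow_eq] using h1 k
  ext a
  rw [← TrivSqZeroExt.inl_fst_add_inr_snd_eq a, map_add, map_add]
  exact congrArg₂ (· + ·) (LinearMap.congr_fun e0 a.fst) (LinearMap.congr_fun e1 a.snd)

lemma AV_ext {V W : Type*} [AddCommGroup V] [Module ℂ V] [AddCommGroup W] [Module ℂ W] {f g : A ⊗[ℂ] V →ₗ[ℂ] W}
    (h0 : ∀ k u, f (tpow k ⊗ₜ u) = g (tpow k ⊗ₜ u))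
    (h1 : ∀ k u, f (opow k ⊗ₜ u) = g (opow k ⊗ₜ u)) : f = g := by
  apply TensorProduct.ext
  refine A_ext (fun k => ?_) (fun k => ?_)
  · ext u; exact h0 k u
  · ext u; exact h1 k u

lemma Xs_mem (m : ℤ) : Xs m ∈ part (V := tSub) 0 := by
  change L m - L 0 ∈ part (V := SBar) 0
  simp [mem_S_zero, L]

lemma Ys_mem (m : ℤ) : Ys m ∈ part (V := tSub) 1 := by
  change G m - G 0 ∈ part (V := SBar) 1
  simp [mem_S_one, G]

lemma sbr_Xs_Xs (m n : ℤ) : sbr (Xs m) (Xs n) =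
    ((n : ℂ) - m) • Xs (m + n) - (n : ℂ) • Xs n + (m : ℂ) • Xs m := by
  apply Subtype.ext
  change sBracket (L m - L 0) (L n - L 0) = ((n : ℂ) - m) • (L (m + n) - L 0) -
    (n : ℂ) • (L n - L 0) + (m : ℂ) • (L m - L 0)
  simp only [map_sub, LinearMap.sub_apply, sBracket_L_L, add_zero, zero_add]
  push_cast
  module

lemma sbr_Xs_Ys (m n : ℤ) : sbr (Xs m) (Ys n) =
    ((n : ℂ) - m / 2) • Ys (n + m) - (n : ℂ) • Ys n + ((m : ℂ) / 2) • Ys m := by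
  apply Subtype.ext
  change sBracket (L m - L 0) (G n - G 0) = ((n : ℂ) - m / 2) • (G (n + m) - G 0) -
    (n : ℂ) • (G n - G 0) + ((m : ℂ) / 2) • (G m - G 0)
  simp only [map_sub, LinearMap.sub_apply, sBracket_L_G, add_zero, zero_add]
  push_cast
  module

lemma sbr_Ys_Ys (m n : ℤ) : sbr (Ys m) (Ys n) =
    (2 : ℂ) • (Xs m + Xs n - Xs (m + n)) := by
  apply Subtype.ext
  change sBracket (G m - G 0) (G n - G 0) =
    (2 : ℂ) • ((L m - L 0) + (L n - L 0) - (L (m + n) - L 0))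
  simp only [map_sub, LinearMap.sub_apply, sBracket_G_G, add_zero, zero_add]
  module

lemma act_XX (σ : SuperRep tSub V) (m n : ℤ) (u : V) :
    σ.act (Xs m) (σ.act (Xs n) u) = σ.act (Xs n) (σ.act (Xs m) u) +
      ((n : ℂ) - m) • σ.act (Xs (m + n)) u - (n : ℂ) • σ.act (Xs n) u + (m : ℂ) • σ.act (Xs m) u := by
  have h := LinearMap.congr_fun (σ.act_sbr 0 0 _ _ (Xs_mem m) (Xs_mem n)) u
  simp only [sbr_Xs_Xs, koszul_zero_left, one_smul, map_add, map_sub, map_smul,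
    LinearMap.add_apply, LinearMap.sub_apply, LinearMap.smul_apply, Module.End.mul_apply] at h
  rw [eq_sub_iff_add_eq] at h
  rw [← h]; abel

lemma act_XY (σ : SuperRep tSub V) (m n : ℤ) (u : V) :
    σ.act (Xs m) (σ.act (Ys n) u) = σ.act (Ys n) (σ.act (Xs m) u) +
      ((n : ℂ) - m / 2) • σ.act (Ys (m + n)) u - (n : ℂ) • σ.act (Ys n) u +
      ((m : ℂ) / 2) • σ.act (Ys m) u := by
  have h := LinearMap.congr_fun (σ.act_sbr 0 1 _ _ (Xs_mem m) (Ys_mem n)) u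
  simp only [sbr_Xs_Ys, koszul_zero_left, one_smul, map_add, map_sub, map_smul, add_comm n m,
    LinearMap.add_apply, LinearMap.sub_apply, LinearMap.smul_apply, Module.End.mul_apply] at h
  rw [eq_sub_iff_add_eq] at h
  rw [← h]; abel

lemma act_YY (σ : SuperRep tSub V) (m n : ℤ) (u : V) :
    σ.act (Ys m) (σ.act (Ys n) u) = -σ.act (Ys n) (σ.act (Ys m) u) +
      (2 : ℂ) • (σ.act (Xs m) u + σ.act (Xs n) u - σ.act (Xs (m + n)) u) := by
  have h := LinearMap.congr_fun (σ.act_sbr 1 1 _ _ (Ys_mem m) (Ys_mem n)) u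
  simp only [sbr_Ys_Ys, koszul_one_one, map_add, map_sub, map_smul, neg_smul, one_smul,
    LinearMap.add_apply, LinearMap.sub_apply, LinearMap.smul_apply, LinearMap.neg_apply,
    Module.End.mul_apply] at h
  rw [h]; abel

lemma gammaL_gammaL (lam : ℂ) (σ : SuperRep tSub V) (m n : ℤ) :
    ((n : ℂ) - m) • gammaL lam σ (m + n) =
      gammaL lam σ m * gammaL lam σ n - gammaL lam σ n * gammaL lam σ m := by
  refine AV_ext (fun k u => ?_) (fun k u => ?_) <;>
  simp only [LinearMap.smul_apply, LinearMap.sub_apply, Module.End.mul_apply, gammaL_tpow,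
    gammaL_opow, map_add, map_sub, map_smul, add_left_comm n m k, ← add_assoc m n k]
  · rw [act_XX σ m n, act_XY σ m n, act_XY σ n m, add_comm n m]
    simp only [TensorProduct.tmul_add, TensorProduct.tmul_sub, TensorProduct.tmul_smul]
    push_cast
    module
  · rw [act_XX σ m n]
    simp only [TensorProduct.tmul_add, TensorProduct.tmul_sub, TensorProduct.tmul_smul]
    push_cast
    module

lemma gammaL_gammaG (lam : ℂ) (σ : SuperRep tSub V) (m n : ℤ) :
    ((n : ℂ) - m / 2) • gammaG lam σ (n + m) =
      gammaL lam σ m * gammaG lam σ n - gammaG lam σ n * gammaL lam σ m := by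
  rw [add_comm n m]
  refine AV_ext (fun k u => ?_) (fun k u => ?_) <;>
  simp only [LinearMap.smul_apply, LinearMap.sub_apply, Module.End.mul_apply, gammaL_tpow,
    gammaL_opow, gammaG_tpow, gammaG_opow, map_add, map_sub, map_smul, map_neg,
    add_left_comm n m k, ← add_assoc m n k]
  · rw [act_XX σ m n, act_XY σ m n, act_YY σ m n]
    simp only [TensorProduct.tmul_add, TensorProduct.tmul_sub, TensorProduct.tmul_smul,
      TensorProduct.tmul_neg]
    push_cast
    module
  · rw [act_XY σ m n]
    simp only [TensorProduct.tmul_add, TensorProduct.tmul_sub, TensorProduct.tmul_smul]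
    push_cast
    module

lemma gammaG_gammaG (lam : ℂ) (σ : SuperRep tSub V) (m n : ℤ) :
    (-2 : ℂ) • gammaL lam σ (m + n) =
      gammaG lam σ m * gammaG lam σ n + gammaG lam σ n * gammaG lam σ m := by
  refine AV_ext (fun k u => ?_) (fun k u => ?_) <;>
  simp only [LinearMap.smul_apply, LinearMap.add_apply, Module.End.mul_apply, gammaL_tpow,
    gammaL_opow, gammaG_tpow, gammaG_opow, map_add, map_sub, map_smul, map_neg,
    add_left_comm n m k, ← add_assoc m n k]
  · rw [act_XY σ m n, act_XY σ n m, act_YY σ m n, add_comm n m]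
    simp only [TensorProduct.tmul_add, TensorProduct.tmul_sub, TensorProduct.tmul_smul,
      TensorProduct.tmul_neg]
    push_cast
    module
  · rw [act_YY σ m n]
    simp only [TensorProduct.tmul_add, TensorProduct.tmul_sub, TensorProduct.tmul_smul,
      TensorProduct.tmul_neg]
    push_cast
    module

lemma mul_act_tpow (n k : ℤ) (u : V) :
    LinearMap.rTensor V (LinearMap.mulLeft ℂ (tpow n)) (tpow k ⊗ₜ u) = tpow (n + k) ⊗ₜ[ℂ] u := by
  simp [tpow_mul_tpow]

lemma mul_act_tpow' (n k : ℤ) (u : V) :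
    LinearMap.rTensor V (LinearMap.mulLeft ℂ (tpow n)) (opow k ⊗ₜ u) = opow (n + k) ⊗ₜ[ℂ] u := by
  simp [tpow_mul_opow]

lemma mul_act_opow (n k : ℤ) (u : V) :
    LinearMap.rTensor V (LinearMap.mulLeft ℂ (opow n)) (tpow k ⊗ₜ u) = opow (n + k) ⊗ₜ[ℂ] u := by
  simp [opow_mul_tpow]

lemma mul_act_opow' (n k : ℤ) (u : V) :
    LinearMap.rTensor V (LinearMap.mulLeft ℂ (opow n)) (opow k ⊗ₜ[ℂ] u) = 0 := by
  simp [opow_mul_opow]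

lemma actA_L_tpow (m n : ℤ) : actA (L m) (tpow n) = (n : ℂ) • tpow (m + n) := by
  simp only [actA_L, tdt_tpow, dxi_tpow, mul_smul_comm, tpow_mul_tpow, mul_zero, smul_zero,
    add_zero]

lemma actA_L_opow (m n : ℤ) : actA (L m) (opow n) = ((n : ℂ) + m / 2) • opow (m + n) := by
  rw [actA_L, tdt_opow, dxi_opow, ← mul_assoc, tpow_mul_xi, opow_mul_tpow, mul_smul_comm,
    tpow_mul_opow, add_smul]

lemma actA_G_tpow (m n : ℤ) : actA (G m) (tpow n) = (n : ℂ) • opow (m + n) := by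
  rw [actA_G, tdt_tpow, dxi_tpow, ← mul_assoc, tpow_mul_xi, mul_smul_comm, opow_mul_tpow,
    mul_zero, sub_zero]

lemma actA_G_opow (m n : ℤ) : actA (G m) (opow n) = -tpow (m + n) := by
  rw [actA_G, tdt_opow, dxi_opow, ← mul_assoc, tpow_mul_xi, mul_smul_comm, opow_mul_opow,
    tpow_mul_tpow, smul_zero, zero_sub]

lemma mulLeft_smul (c : ℂ) (a : A) : LinearMap.rTensor V (LinearMap.mulLeft ℂ (c • a)) =
    c • LinearMap.rTensor V (LinearMap.mulLeft ℂ a) := by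
  apply TensorProduct.ext'
  intro y u
  simp [TensorProduct.smul_tmul']

lemma mulLeft_neg (a : A) : LinearMap.rTensor V (LinearMap.mulLeft ℂ (-a)) =
    -LinearMap.rTensor V (LinearMap.mulLeft ℂ a) := by
  apply TensorProduct.ext'
  intro y u
  simp [TensorProduct.neg_tmul]

lemma gammaL_mul_tpow (lam : ℂ) (σ : SuperRep tSub V) (m n : ℤ) :
    LinearMap.rTensor V (LinearMap.mulLeft ℂ (actA (L m) (tpow n))) =
      gammaL lam σ m * LinearMap.rTensor V (LinearMap.mulLeft ℂ (tpow n)) -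
      LinearMap.rTensor V (LinearMap.mulLeft ℂ (tpow n)) * gammaL lam σ m := by
  rw [actA_L_tpow, mulLeft_smul]
  refine AV_ext (fun k u => ?_) (fun k u => ?_) <;>
  simp only [LinearMap.smul_apply, LinearMap.sub_apply, Module.End.mul_apply, gammaL_tpow,
    gammaL_opow, map_add, map_sub, map_smul, mul_act_tpow, mul_act_tpow', mul_act_opow,
    mul_act_opow', add_left_comm n m k, ← add_assoc m n k] <;> push_cast <;> module

lemma gammaL_mul_opow (lam : ℂ) (σ : SuperRep tSub V) (m n : ℤ) :
    LinearMap.rTensor V (LinearMap.mulLeft ℂ (actA (L m) (opow n))) =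
      gammaL lam σ m * LinearMap.rTensor V (LinearMap.mulLeft ℂ (opow n)) -
      LinearMap.rTensor V (LinearMap.mulLeft ℂ (opow n)) * gammaL lam σ m := by
  rw [actA_L_opow, mulLeft_smul]
  refine AV_ext (fun k u => ?_) (fun k u => ?_) <;>
  simp only [LinearMap.smul_apply, LinearMap.sub_apply, Module.End.mul_apply, gammaL_tpow,
    gammaL_opow, map_add, map_sub, map_smul, map_zero, mul_act_tpow, mul_act_tpow', mul_act_opow,
    mul_act_opow', add_left_comm n m k, ← add_assoc m n k] <;> push_cast <;> module

lemma gammaG_mul_tpow (lam : ℂ) (σ : SuperRep tSub V) (m n : ℤ) :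
    LinearMap.rTensor V (LinearMap.mulLeft ℂ (actA (G m) (tpow n))) =
      gammaG lam σ m * LinearMap.rTensor V (LinearMap.mulLeft ℂ (tpow n)) -
      LinearMap.rTensor V (LinearMap.mulLeft ℂ (tpow n)) * gammaG lam σ m := by
  rw [actA_G_tpow, mulLeft_smul]
  refine AV_ext (fun k u => ?_) (fun k u => ?_) <;>
  simp only [LinearMap.smul_apply, LinearMap.sub_apply, Module.End.mul_apply, gammaG_tpow,
    gammaG_opow, map_add, map_sub, map_smul, map_neg, mul_act_tpow, mul_act_tpow', mul_act_opow,
    mul_act_opow', add_left_comm n m k, ← add_assoc m n k] <;> push_cast <;> module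

lemma gammaG_mul_opow (lam : ℂ) (σ : SuperRep tSub V) (m n : ℤ) :
    LinearMap.rTensor V (LinearMap.mulLeft ℂ (actA (G m) (opow n))) =
      gammaG lam σ m * LinearMap.rTensor V (LinearMap.mulLeft ℂ (opow n)) +
      LinearMap.rTensor V (LinearMap.mulLeft ℂ (opow n)) * gammaG lam σ m := by
  rw [actA_G_opow, mulLeft_neg]
  refine AV_ext (fun k u => ?_) (fun k u => ?_) <;>
  simp only [LinearMap.neg_apply, LinearMap.add_apply, Module.End.mul_apply, gammaG_tpow,
    gammaG_opow, map_add, map_sub, map_smul, map_neg, map_zero, mul_act_tpow, mul_act_tpow',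
    mul_act_opow, mul_act_opow', add_left_comm n m k, ← add_assoc m n k] <;> module

/-- A linear map of parity `a`. -/
def HasParity {V W : Type*} [AddCommGroup V] [Module ℂ V] [SuperSpace V]
    [AddCommGroup W] [Module ℂ W] [SuperSpace W] (a : ZMod 2) (f : V →ₗ[ℂ] W) : Prop :=
  ∀ j, ∀ v ∈ part (V := V) j, f v ∈ part (V := W) (a + j)

lemma HasParity.map {a b c : ZMod 2} {f : A →ₗ[ℂ] A} {g : V →ₗ[ℂ] V} (hf : HasParity a f)
    (hg : HasParity b g) (h : a + b = c) : HasParity c (TensorProduct.map f g) := by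
  intro k
  change tensorPart A V k ≤ (tensorPart A V (c + k)).comap (TensorProduct.map f g)
  refine tensorPart_le fun i j hij v hv w hw => ?_
  simp only [Submodule.mem_comap, TensorProduct.map_tmul]
  refine tmul_mem_tensorPart (hf i v hv) (hg j w hw) ?_
  rw [← h, ← hij]; abel

lemma HasParity.add {a : ZMod 2} {f g : Module.End ℂ (A ⊗[ℂ] V)} (hf : HasParity a f)
    (hg : HasParity a g) : HasParity a (f + g) :=
  fun j v hv => add_mem (hf j v hv) (hg j v hv)

lemma HasParity.sub {a : ZMod 2} {f g : Module.End ℂ (A ⊗[ℂ] V)} (hf : HasParity a f)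
    (hg : HasParity a g) : HasParity a (f - g) :=
  fun j v hv => sub_mem (hf j v hv) (hg j v hv)

lemma HasParity.smul {a : ZMod 2} {f : Module.End ℂ (A ⊗[ℂ] V)} (c : ℂ) (hf : HasParity a f) :
    HasParity a (c • f) :=
  fun j v hv => Submodule.smul_mem _ c (hf j v hv)

lemma HasParity.zero {a : ZMod 2} : HasParity a (0 : Module.End ℂ (A ⊗[ℂ] V)) :=
  fun _ _ _ => zero_mem _

lemma HasParity.id {V : Type*} [AddCommGroup V] [Module ℂ V] [SuperSpace V] :
    HasParity 0 (LinearMap.id : V →ₗ[ℂ] V) := fun j v hv => by simpa using hv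

lemma hasParity_act (σ : SuperRep tSub V) {i : ZMod 2} {x : tSub} (hx : x ∈ part i) :
    HasParity i (σ.act x) := fun j v hv => σ.act_mem i j x v hx hv

lemma HasParity.comp {a b c : ZMod 2} {f g : A →ₗ[ℂ] A} (hf : HasParity a f)
    (hg : HasParity b g) (h : a + b = c) : HasParity c (f ∘ₗ g) := fun j v hv => by
  have := hf _ _ (hg j v hv)
  rwa [← add_assoc, h] at this

lemma hasParity_mulLeft {i : ZMod 2} {a : A} (ha : a ∈ part (V := A) i) :
    HasParity i (LinearMap.mulLeft ℂ a) := by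
  intro j v hv
  obtain rfl | rfl := parity_cases i <;> obtain rfl | rfl := parity_cases j <;>
  simp only [mem_A_zero, mem_A_one, add_zero, zero_add, one_add_one_parity,
    LinearMap.mulLeft_apply] at ha hv ⊢ <;> simp [ha, hv]

lemma hasParity_parA : HasParity 0 parA := by
  intro j v hv
  obtain rfl | rfl := parity_cases j <;>
  simp only [mem_A_zero, mem_A_one, add_zero, zero_add] at hv ⊢ <;> simp [fst_parA, snd_parA, hv]

lemma hasParity_shift (lam : ℂ) : HasParity 0 (lam • LinearMap.id + tdt : A →ₗ[ℂ] A) := by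
  intro j v hv
  obtain rfl | rfl := parity_cases j <;>
  simp only [mem_A_zero, mem_A_one, add_zero, zero_add] at hv ⊢ <;> simp [tdt, hv]

lemma hasParity_dxi : HasParity 1 dxi := by
  intro j v hv
  obtain rfl | rfl := parity_cases j <;>
  simp only [mem_A_zero, mem_A_one, add_zero, one_add_one_parity] at hv ⊢ <;> simp [dxi, hv]

lemma tpow_mem (m : ℤ) : tpow m ∈ part (V := A) 0 := by simp [mem_A_zero, tpow]

lemma opow_mem (m : ℤ) : opow m ∈ part (V := A) 1 := by simp [mem_A_one, opow_eq]

lemma hasParity_gammaL (lam : ℂ) (σ : SuperRep tSub V) (m : ℤ) :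
    HasParity 0 (gammaL lam σ m) := by
  have ht := hasParity_mulLeft (tpow_mem m)
  have ho := hasParity_mulLeft (opow_mem m)
  refine HasParity.add (HasParity.add (HasParity.sub ?_ (HasParity.smul _ ?_)) ?_)
    (HasParity.smul _ ?_)
  · exact HasParity.map ht (hasParity_act σ (Xs_mem m)) (by decide)
  · exact HasParity.map (HasParity.comp ho hasParity_parA (c := 1) (by decide))
      (hasParity_act σ (Ys_mem m)) (by decide)
  · exact HasParity.map (HasParity.comp ht (hasParity_shift lam) (c := 0) (by decide))
      HasParity.id (by decide)
  · exact HasParity.map (HasParity.comp ho hasParity_dxi (c := 0) (by decide))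
      HasParity.id (by decide)

lemma hasParity_gammaG (lam : ℂ) (σ : SuperRep tSub V) (m : ℤ) :
    HasParity 1 (gammaG lam σ m) := by
  have ht := hasParity_mulLeft (tpow_mem m)
  have ho := hasParity_mulLeft (opow_mem m)
  refine HasParity.sub (HasParity.add (HasParity.add ?_ (HasParity.smul _ ?_)) ?_) ?_
  · exact HasParity.map (HasParity.comp ht hasParity_parA (c := 0) (by decide))
      (hasParity_act σ (Ys_mem m)) (by decide)
  · exact HasParity.map ho (hasParity_act σ (Xs_mem m)) (by decide)
  · exact HasParity.map (HasParity.comp ho (hasParity_shift lam) (c := 1) (by decide))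
      HasParity.id (by decide)
  · exact HasParity.map (HasParity.comp ht hasParity_dxi (c := 1) (by decide))
      HasParity.id (by decide)

/-- Homogeneous bases of the two parts of `s̃`. -/
def stBasis (i : ZMod 2) : Set STilde :=
  if i = 0 then Set.range (fun n => (L n, 0)) ∪ Set.range (fun n => (0, tpow n))
  else Set.range (fun n => (G n, 0)) ∪ Set.range (fun n => (0, opow n))

lemma laurent_mem_of_T {W : Type*} [AddCommGroup W] [Module ℂ W] (N : Submodule ℂ W)
    (φ : ℂ[T;T⁻¹] →ₗ[ℂ] W) (h : ∀ n, φ (LaurentPolynomial.T n) ∈ N) (f : ℂ[T;T⁻¹]) : φ f ∈ N := by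
  rw [← Submodule.Quotient.mk_eq_zero]
  have : N.mkQ ∘ₗ φ = 0 := laurent_ext fun n => by simpa using h n
  exact LinearMap.congr_fun this f

lemma mem_span_stBasis {i : ZMod 2} {X : STilde} (hX : X ∈ part (V := STilde) i) :
    X ∈ Submodule.span ℂ (stBasis i) := by
  obtain ⟨⟨x1, x2⟩, a⟩ := X
  obtain rfl | rfl := parity_cases i
  · simp only [mem_St, mem_S_zero, mem_A_zero] at hX
    obtain ⟨rfl, ha⟩ := hX
    have e : (((x1, 0), a) : STilde) = ((x1, 0), 0) + (0, TrivSqZeroExt.inl a.fst) := by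
      refine Prod.ext (by simp) (TrivSqZeroExt.ext ?_ ?_) <;> simp [ha]
    rw [e]
    refine add_mem ?_ ?_
    · exact laurent_mem_of_T _ (LinearMap.inl ℂ SBar A ∘ₗ LinearMap.inl ℂ _ _)
        (fun n => Submodule.subset_span (by left; exact ⟨n, rfl⟩)) x1
    · exact laurent_mem_of_T _ (LinearMap.inr ℂ SBar A ∘ₗ
        (TrivSqZeroExt.inlAlgHom ℂ ℂ[T;T⁻¹] ℂ[T;T⁻¹]).toLinearMap)
        (fun n => Submodule.subset_span (by right; exact ⟨n, rfl⟩)) a.fst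
  · simp only [mem_St, mem_S_one, mem_A_one] at hX
    obtain ⟨rfl, ha⟩ := hX
    have e : (((0, x2), a) : STilde) = ((0, x2), 0) + (0, TrivSqZeroExt.inr a.snd) := by
      refine Prod.ext (by simp) (TrivSqZeroExt.ext ?_ ?_) <;> simp [ha]
    rw [e]
    refine add_mem ?_ ?_
    · exact laurent_mem_of_T _ (LinearMap.inl ℂ SBar A ∘ₗ LinearMap.inr ℂ _ _)
        (fun n => Submodule.subset_span (by left; exact ⟨n, rfl⟩)) x2
    · exact laurent_mem_of_T _ (LinearMap.inr ℂ SBar A ∘ₗ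
        (TrivSqZeroExt.inrHom ℂ[T;T⁻¹] ℂ[T;T⁻¹]).restrictScalars ℂ)
        (fun n => Submodule.subset_span (by right; exact ⟨n, by simp [opow_eq]⟩)) a.snd

lemma stBracket_S_S (x y : SBar) : stBracket (x, 0) (y, 0) = (sBracket x y, 0) := by
  simp [stBracket_apply]

lemma stBracket_S_A (x : SBar) (b : A) : stBracket (x, 0) (0, b) = (0, actA x b) := by
  have h : ((0 : ℂ[T;T⁻¹]), (0 : ℂ[T;T⁻¹])) = 0 := rfl
  simp [stBracket_apply, h]

lemma stBracket_A_A (a b : A) : stBracket (0, a) (0, b) = 0 := by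
  have h : ((0 : ℂ[T;T⁻¹]), (0 : ℂ[T;T⁻¹])) = 0 := rfl
  simp [stBracket_apply, h]

lemma stBracket_A_L (a : A) (m : ℤ) : stBracket (0, a) (L m, 0) = (0, -actA (L m) a) := by
  have h : ((0 : ℂ[T;T⁻¹]), (0 : ℂ[T;T⁻¹])) = 0 := rfl
  simp [stBracket_apply, L, h]

lemma stBracket_A_G (a : A) (m : ℤ) : stBracket (0, a) (G m, 0) = (0, -actA (G m) (parA a)) := by
  have h : ((0 : ℂ[T;T⁻¹]), (0 : ℂ[T;T⁻¹])) = 0 := rfl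
  simp [stBracket_apply, G, h]

lemma mulLeft_comm (a b : A) : LinearMap.rTensor V (LinearMap.mulLeft ℂ a) *
    LinearMap.rTensor V (LinearMap.mulLeft ℂ b) =
    LinearMap.rTensor V (LinearMap.mulLeft ℂ b) * LinearMap.rTensor V (LinearMap.mulLeft ℂ a) := by
  apply TensorProduct.ext'
  intro y u
  simp [mul_left_comm a b y]

lemma mulLeft_opow_opow (m n : ℤ) : LinearMap.rTensor V (LinearMap.mulLeft ℂ (opow m)) *
    LinearMap.rTensor V (LinearMap.mulLeft ℂ (opow n)) = 0 := by
  apply TensorProduct.ext'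
  intro y u
  simp [← mul_assoc, opow_mul_opow]

/-- `Γ(λ, V)`: the superspace `A ⊗ V` with the action `gammaAct` of `s̃`. -/
def Gamma (lam : ℂ) (σ : SuperRep tSub V) : SuperRep STilde (A ⊗[ℂ] V) where
  act := gammaAct lam σ
  act_mem i j x v hx hv := by
    have hpar : ∀ x ∈ Submodule.span ℂ (stBasis i), HasParity i (gammaAct lam σ x) := by
      intro x hx
      induction hx using Submodule.span_induction with
      | zero => rw [map_zero]; exact HasParity.zero
      | add x y _ _ h h' => rw [map_add]; exact h.add h'
      | smul c x _ h => rw [map_smul]; exact h.smul c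
      | mem x h =>
        obtain rfl | rfl := parity_cases i
        · rcases h with ⟨n, rfl⟩ | ⟨n, rfl⟩
          · simp only [gammaAct_L]; exact hasParity_gammaL lam σ n
          · simp only [gammaAct_A]
            exact HasParity.map (hasParity_mulLeft (tpow_mem n)) HasParity.id (by decide)
        · rcases h with ⟨n, rfl⟩ | ⟨n, rfl⟩
          · simp only [gammaAct_G]; exact hasParity_gammaG lam σ n
          · simp only [gammaAct_A]
            exact HasParity.map (hasParity_mulLeft (opow_mem n)) HasParity.id (by decide)
    exact hpar x (mem_span_stBasis hx) j v hv
  act_sbr i j x y hx hy := by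
    let B : STilde →ₗ[ℂ] STilde →ₗ[ℂ] Module.End ℂ (A ⊗[ℂ] V) := LinearMap.mk₂ ℂ
      (fun x y => gammaAct lam σ (stBracket x y) - (gammaAct lam σ x * gammaAct lam σ y -
        koszul i j • (gammaAct lam σ y * gammaAct lam σ x)))
      (fun x x' y => by
        simp only [map_add, LinearMap.add_apply, mul_add, add_mul, smul_add]; abel)
      (fun c x y => by
        refine LinearMap.ext fun z => ?_
        simp only [map_smul, LinearMap.smul_apply, LinearMap.sub_apply, Module.End.mul_apply]
        module)
      (fun x y y' => by
        simp only [map_add, mul_add, add_mul, smul_add]; abel)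
      (fun c x y => by
        refine LinearMap.ext fun z => ?_
        simp only [map_smul, LinearMap.smul_apply, LinearMap.sub_apply, Module.End.mul_apply]
        module)
    suffices h : B x y ∈ (⊥ : Submodule ℂ (Module.End ℂ (A ⊗[ℂ] V))) from
      sub_eq_zero.1 ((Submodule.mem_bot ℂ).1 h)
    refine LinearMap.BilinMap.apply_apply_mem_of_mem_span ⊥ (stBasis i) (stBasis j) B ?_ x y
      (mem_span_stBasis hx) (mem_span_stBasis hy)
    clear hx hy x y
    intro x hx y hy
    rw [Submodule.mem_bot]
    change gammaAct lam σ (stBracket x y) - (gammaAct lam σ x * gammaAct lam σ y -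
      koszul i j • (gammaAct lam σ y * gammaAct lam σ x)) = 0
    refine (sub_eq_zero (G := Module.End ℂ (A ⊗[ℂ] V))).2 ?_
    have hS : ∀ (c : ℂ) (z : SBar), ((c • z, (0 : A)) : STilde) = c • (z, 0) := by
      intro c z; simp
    have hN : ∀ (z : SBar), ((-z, (0 : A)) : STilde) = -(z, 0) := by
      intro z; simp
    have hself : ∀ f : Module.End ℂ (A ⊗[ℂ] V), f - f = 0 := fun f => sub_self f
    have hneg : ∀ f g : Module.End ℂ (A ⊗[ℂ] V), f - (-1 : ℂ) • g = f + g := by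
      intro f g
      refine LinearMap.ext fun z => ?_
      simp only [LinearMap.add_apply, LinearMap.sub_apply, LinearMap.smul_apply]
      module
    obtain rfl | rfl := parity_cases i <;> obtain rfl | rfl := parity_cases j
    · rcases hx with ⟨m, rfl⟩ | ⟨m, rfl⟩ <;> rcases hy with ⟨n, rfl⟩ | ⟨n, rfl⟩ <;>
      simp only [koszul_zero_left, one_smul]
      · rw [stBracket_S_S, sBracket_L_L, hS, map_smul, gammaAct_L, gammaAct_L, gammaAct_L,
          gammaL_gammaL]
      · rw [stBracket_S_A, gammaAct_A, gammaAct_A, gammaAct_L, gammaL_mul_tpow lam σ]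
      · rw [stBracket_A_L, gammaAct_A, gammaAct_A, gammaAct_L, mulLeft_neg, gammaL_mul_tpow lam σ]
        abel
      · rw [stBracket_A_A, gammaAct_A, gammaAct_A, map_zero, mulLeft_comm, hself]
    · rcases hx with ⟨m, rfl⟩ | ⟨m, rfl⟩ <;> rcases hy with ⟨n, rfl⟩ | ⟨n, rfl⟩ <;>
      simp only [koszul_zero_left, one_smul]
      · rw [stBracket_S_S, sBracket_L_G, hS, map_smul, gammaAct_L, gammaAct_G, gammaAct_G,
          gammaL_gammaG]
      · rw [stBracket_S_A, gammaAct_A, gammaAct_A, gammaAct_L, gammaL_mul_opow lam σ]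
      · rw [stBracket_A_G, gammaAct_A, gammaAct_A, gammaAct_G, parA_tpow, mulLeft_neg,
          gammaG_mul_tpow lam σ]
        abel
      · rw [stBracket_A_A, gammaAct_A, gammaAct_A, map_zero, mulLeft_comm, hself]
    · rcases hx with ⟨m, rfl⟩ | ⟨m, rfl⟩ <;> rcases hy with ⟨n, rfl⟩ | ⟨n, rfl⟩ <;>
      simp only [koszul_zero_right, one_smul]
      · rw [stBracket_S_S, sBracket_G_L, hN, hS, map_neg, map_smul, gammaAct_L, gammaAct_G,
          gammaAct_G, gammaL_gammaG]
        abel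
      · rw [stBracket_S_A, gammaAct_A, gammaAct_A, gammaAct_G, gammaG_mul_tpow lam σ]
      · rw [stBracket_A_L, gammaAct_A, gammaAct_A, gammaAct_L, mulLeft_neg, gammaL_mul_opow lam σ]
        abel
      · rw [stBracket_A_A, gammaAct_A, gammaAct_A, map_zero, mulLeft_comm, hself]
    · rcases hx with ⟨m, rfl⟩ | ⟨m, rfl⟩ <;> rcases hy with ⟨n, rfl⟩ | ⟨n, rfl⟩ <;>
      rw [koszul_one_one, hneg]
      · rw [stBracket_S_S, sBracket_G_G, hS, map_smul, gammaAct_L, gammaAct_G, gammaAct_G,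
          gammaG_gammaG]
      · rw [stBracket_S_A, gammaAct_A, gammaAct_A, gammaAct_G, gammaG_mul_opow lam σ]
      · rw [stBracket_A_G, gammaAct_A, gammaAct_A, gammaAct_G, parA_opow, map_neg, neg_neg,
          gammaG_mul_opow lam σ, add_comm]
      · rw [stBracket_A_A, gammaAct_A, gammaAct_A, map_zero, mulLeft_opow_opow, mulLeft_opow_opow,
          add_zero]

end Gamma

/-! ### Weight modules and `A s̄`-modules -/

section

variable {M : Type*} [AddCommGroup M] [Module ℂ M] [SuperSpace M]

/-- An `A s̄`-module is an `s̃`-module on which `A` acts associatively (and unitally). -/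
def IsAssoc (ρ : SuperRep STilde M) : Prop :=
  ρ.act (0, 1) = 1 ∧ ∀ a b : A, ρ.act (0, a * b) = ρ.act (0, a) * ρ.act (0, b)

/-- A weight module: `L_0` acts diagonalizably. -/
def IsWeight (ρ : SuperRep STilde M) : Prop :=
  (⨆ μ : ℂ, Module.End.eigenspace (ρ.act (L 0, 0)) μ) = ⊤

/-- The support: the set of weights with nonzero weight space. -/
def support (ρ : SuperRep STilde M) : Set ℂ :=
  {μ | Module.End.eigenspace (ρ.act (L 0, 0)) μ ≠ ⊥}

end

end Ramond

end

noncomputable section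

namespace Ramond

open SuperSpace LieSuperalgebra

/-! ### Superspaces -/

section Superspace

variable {V : Type*} [AddCommGroup V] [Module ℂ V] [SuperSpace V]

/-! Everything is read off the copy `ξ ⊗ V` of `V` inside `Γ(λ, V)`. Put `X_m = L_m - L_0` and `Y_m
= G_m - G_0`. On `ξ ⊗ u` the formulas lose their terms with an extra `ξ`: `L_m` gives `t^m ξ ⊗ X_m
u` plus the scalar `λ + m/2` times `t^m ξ ⊗ u`, and `G_m` gives `-t^m ξ ⊗ Y_m u - t^m ⊗ u`. In
particular `G_0 (ξ ⊗ u) = -1 ⊗ u`, so `ξ` and `G_0` move between the two copies of `V` in the weight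
space of weight `λ`.

Simplicity of `Γ(λ, V)`: `L_0` acts by `λ + t∂_t`, so a nonzero submodule `N` contains a nonzero
weight vector, which a power of `t` moves to `1 ⊗ u + ξ ⊗ v`. Multiplication by `ξ` and then `G_0`
show that the subspace of all `u` with `1 ⊗ u ∈ N` is nonzero. The formulas on `ξ ⊗ u` make it a
submodule of `V`, hence all of `V` (`isSimple_Gamma`).

Classification: for any weight `λ` of `M`, let `V` be the kernel of `ξ` in the weight space of
weight `λ`, in the role of `ξ ⊗ V` and hence with reversed parity. Solving the formulas above for
the action on `V` forces `X_m` to act as `t^(-m) L_m - L_0 - m/2` and `Y_m` as `G_0 - t^(-m) G_m`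
(`xiKerRep`). As `1 ⊗ u` corresponds to `-G_0 (ξ ⊗ u)`, the comparison map has to be `a ⊗ u ↦ -a G_0
u` (`fromGamma`), and it intertwines the actions (`fromGamma_act`). A nonzero kernel would contain a
nonzero `1 ⊗ u + ξ ⊗ v`, which applying `ξ` in `M` excludes (`injective_fromGamma`). The image is a
nonzero graded submodule, hence all of `M` (`surjective_fromGamma`). Finally `V` is simple because a
submodule `W` of `V` yields the submodule `A ⊗ W` of `Γ(λ, V)` (`isSimple_of_Gamma`). -/

lemma parts_unique {a b c d : V} (ha : a ∈ part (V := V) 0) (hb : b ∈ part (V := V) 1)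
    (hc : c ∈ part (V := V) 0) (hd : d ∈ part (V := V) 1) (h : a + b = c + d) :
    a = c ∧ b = d := by
  have h0 : a - c ∈ part (V := V) 0 := sub_mem ha hc
  have h1 : a - c ∈ part (V := V) 1 := by
    have : a - c = d - b := by rw [sub_eq_sub_iff_add_eq_add, h, add_comm]
    rw [this]; exact sub_mem hd hb
  have h2 := (Submodule.disjoint_def.1 (SuperSpace.isCompl (V := V)).disjoint) _ h0 h1
  have h3 : a = c := sub_eq_zero.1 h2
  exact ⟨h3, by rw [h3] at h; exact add_left_cancel h⟩

/-- A subspace is graded if it contains the homogeneous components of its elements. -/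
def IsGraded (N : Submodule ℂ V) : Prop :=
  N = (N ⊓ part 0) ⊔ (N ⊓ part 1)

lemma IsGraded.mem {N : Submodule ℂ V} (h : IsGraded N) {a b : V}
    (ha : a ∈ part (V := V) 0) (hb : b ∈ part (V := V) 1) (hab : a + b ∈ N) : a ∈ N ∧ b ∈ N := by
  rw [IsGraded] at h
  rw [h] at hab
  obtain ⟨c, hc, d, hd, e⟩ := Submodule.mem_sup.1 hab
  obtain ⟨rfl, rfl⟩ := parts_unique hc.2 hd.2 ha hb e
  exact ⟨hc.1, hd.1⟩

/-- Only the even component has to be tested; the odd one then follows by subtraction. -/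
lemma isGraded_of_mem {N : Submodule ℂ V} (h : ∀ a ∈ part (V := V) 0, ∀ b ∈ part (V := V) 1,
    a + b ∈ N → a ∈ N) : IsGraded N := by
  refine le_antisymm (fun x hx => ?_) (sup_le inf_le_left inf_le_left)
  obtain ⟨a, ha, b, hb, rfl⟩ := exists_add_of_superSpace x
  have haN := h a ha b hb hx
  exact Submodule.add_mem_sup ⟨haN, ha⟩ ⟨(Submodule.add_mem_iff_right N haN).1 hx, hb⟩

variable {W : Type*} [AddCommGroup W] [Module ℂ W] [SuperSpace W]

lemma isGraded_range {f : V →ₗ[ℂ] W} (hf : HasParity 0 f) : IsGraded (LinearMap.range f) := by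
  refine isGraded_of_mem fun a ha b hb => ?_
  rintro ⟨x, hx⟩
  obtain ⟨c, hc, d, hd, rfl⟩ := exists_add_of_superSpace x
  rw [map_add] at hx
  have h0 := hf 0 c hc
  have h1 := hf 1 d hd
  exact ⟨c, (parts_unique (by simpa using h0) (by simpa using h1) ha hb hx).1⟩

lemma isGraded_ker {i : ZMod 2} {f : V →ₗ[ℂ] W} (hf : HasParity i f) :
    IsGraded (LinearMap.ker f) := by
  refine isGraded_of_mem fun a ha b hb hab => ?_
  rw [LinearMap.mem_ker, map_add] at hab
  have h0 := hf 0 a ha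
  have h1 := hf 1 b hb
  rw [LinearMap.mem_ker]
  obtain rfl | rfl := parity_cases i
  · rw [← add_zero (0 : W)] at hab
    exact (parts_unique (by simpa using h0) (by simpa using h1) (zero_mem _) (zero_mem _) hab).1
  -- An odd map exchanges the two parts, so the image of the even component `a` is now the odd
  -- summand.
  · rw [← add_zero (0 : W), add_comm] at hab
    exact (parts_unique (by simpa [one_add_one_parity] using h1) (by simpa using h0)
      (zero_mem _) (zero_mem _) hab).2

lemma IsGraded.inf {N N' : Submodule ℂ V} (h : IsGraded N) (h' : IsGraded N') :
    IsGraded (N ⊓ N') :=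
  isGraded_of_mem fun _ ha _ hb hab => ⟨(h.mem ha hb hab.1).1, (h'.mem ha hb hab.2).1⟩

end Superspace

/-! ### Generators of `s̃` and of `(t - 1) s̄` -/

/-- Any condition linear in `x` need only be checked on the four families of basis vectors. It is
applied to stabilisers of subspaces and to the intertwining condition for `fromGamma`. -/
lemma mem_of_generators {P : Submodule ℂ STilde} (hL : ∀ n, (L n, 0) ∈ P)
    (hG : ∀ n, (G n, 0) ∈ P) (ht : ∀ n, (0, tpow n) ∈ P) (ho : ∀ n, (0, opow n) ∈ P)
    (x : STilde) : x ∈ P := by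
  obtain ⟨a, ha, b, hb, rfl⟩ := exists_add_of_superSpace x
  refine add_mem (Submodule.span_le.2 ?_ (mem_span_stBasis ha))
    (Submodule.span_le.2 ?_ (mem_span_stBasis hb))
  · rintro _ (⟨n, rfl⟩ | ⟨n, rfl⟩)
    exacts [hL n, ht n]
  · rintro _ (⟨n, rfl⟩ | ⟨n, rfl⟩)
    exacts [hG n, ho n]

/-- The homogeneous spanning sets of `(t - 1) s̄`. -/
def tSubBasis (i : ZMod 2) : Set tSub := if i = 0 then Set.range Xs else Set.range Ys

lemma mem_span_tSubBasis {i : ZMod 2} {x : tSub} (hx : x ∈ part (V := tSub) i) :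
    x ∈ Submodule.span ℂ (tSubBasis i) := by
  obtain ⟨⟨f, g⟩, hfg⟩ := x
  obtain ⟨⟨f, rfl⟩, ⟨g, rfl⟩⟩ := mem_tSub.1 hfg
  -- Telescoping: `(t - 1) t^n = (t^(n+1) - 1) - (t^n - 1)`, so `(t - 1) L_n = X_(n+1) - X_n`, and
  -- likewise for `G`.
  have hT (n : ℤ) : (LaurentPolynomial.T 1 - 1 : ℂ[T;T⁻¹]) * LaurentPolynomial.T n =
      (LaurentPolynomial.T (n + 1) - LaurentPolynomial.T 0) -
        (LaurentPolynomial.T n - LaurentPolynomial.T 0) := by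
    rw [sub_mul, T_mul_T, add_comm]; ring
  obtain rfl | rfl := parity_cases i
  · have hx : (LaurentPolynomial.T 1 - 1 : ℂ[T;T⁻¹]) * g = 0 := mem_S_zero.1 hx
    let φ : ℂ[T;T⁻¹] →ₗ[ℂ] tSub := LinearMap.codRestrict tSub
      (LinearMap.inl ℂ _ _ ∘ₗ LinearMap.mulLeft ℂ (LaurentPolynomial.T 1 - 1))
      (fun h => mem_tSub.2 ⟨⟨h, rfl⟩, dvd_zero _⟩)
    have e : (⟨_, hfg⟩ : tSub) = φ f := Subtype.ext (Prod.ext rfl hx)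
    rw [e]
    refine laurent_mem_of_T _ φ (fun n => ?_) f
    have : φ (LaurentPolynomial.T n) = Xs (n + 1) - Xs n :=
      Subtype.ext (Prod.ext (by simpa [φ, Xs, L] using hT n) (by simp [φ, Xs, L]))
    rw [this]
    exact sub_mem (Submodule.subset_span ⟨_, rfl⟩) (Submodule.subset_span ⟨_, rfl⟩)
  · have hx : (LaurentPolynomial.T 1 - 1 : ℂ[T;T⁻¹]) * f = 0 := mem_S_one.1 hx
    let φ : ℂ[T;T⁻¹] →ₗ[ℂ] tSub := LinearMap.codRestrict tSub
      (LinearMap.inr ℂ _ _ ∘ₗ LinearMap.mulLeft ℂ (LaurentPolynomial.T 1 - 1))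
      (fun h => mem_tSub.2 ⟨dvd_zero _, ⟨h, rfl⟩⟩)
    have e : (⟨_, hfg⟩ : tSub) = φ g := Subtype.ext (Prod.ext hx rfl)
    rw [e]
    refine laurent_mem_of_T _ φ (fun n => ?_) g
    have : φ (LaurentPolynomial.T n) = Ys (n + 1) - Ys n :=
      Subtype.ext (Prod.ext (by simp [φ, Ys, G]) (by simpa [φ, Ys, G] using hT n))
    rw [this]
    exact sub_mem (Submodule.subset_span ⟨_, rfl⟩) (Submodule.subset_span ⟨_, rfl⟩)

lemma mem_of_tSub_generators {P : Submodule ℂ tSub} (hX : ∀ n, Xs n ∈ P) (hY : ∀ n, Ys n ∈ P)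
    (x : tSub) : x ∈ P := by
  obtain ⟨a, ha, b, hb, rfl⟩ := exists_add_of_superSpace x
  refine add_mem (Submodule.span_le.2 ?_ (mem_span_tSubBasis ha))
    (Submodule.span_le.2 ?_ (mem_span_tSubBasis hb))
  · rintro _ ⟨n, rfl⟩; exact hX n
  · rintro _ ⟨n, rfl⟩; exact hY n

/-- The elements of `L` preserving a subspace of an `L`-module. -/
def preserver {L M : Type*} [AddCommGroup L] [Module ℂ L] [AddCommGroup M] [Module ℂ M]
    (act : L →ₗ[ℂ] Module.End ℂ M) (N : Submodule ℂ M) : Submodule ℂ L where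
  carrier := {x | ∀ v ∈ N, act x v ∈ N}
  zero_mem' v _ := by simp
  add_mem' hx hy v hv := by simpa using add_mem (hx v hv) (hy v hv)
  smul_mem' c x hx v hv := by simpa using N.smul_mem c (hx v hv)

/-! ### Simplicity of `Γ(λ, V)` -/

section

variable {V : Type*} [AddCommGroup V] [Module ℂ V] [SuperSpace V]

lemma Gamma_L (lam : ℂ) (σ : SuperRep tSub V) (m : ℤ) :
    (Gamma lam σ).act (L m, 0) = gammaL lam σ m := gammaAct_L lam σ m

lemma Gamma_G (lam : ℂ) (σ : SuperRep tSub V) (m : ℤ) :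
    (Gamma lam σ).act (G m, 0) = gammaG lam σ m := gammaAct_G lam σ m

lemma Gamma_A (lam : ℂ) (σ : SuperRep tSub V) (a : A) :
    (Gamma lam σ).act (0, a) = LinearMap.rTensor V (LinearMap.mulLeft ℂ a) :=
  gammaAct_A lam σ a

lemma isAssoc_Gamma (lam : ℂ) (σ : SuperRep tSub V) : IsAssoc (Gamma lam σ) := by
  refine ⟨?_, fun a b => ?_⟩
  · rw [Gamma_A, LinearMap.mulLeft_one, LinearMap.rTensor_id]; rfl
  · simp only [Gamma_A, LinearMap.mulLeft_mul, LinearMap.rTensor_comp]; rfl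

/-! ### Weight vectors of `Γ(λ, V)` -/

lemma Xs_zero : Xs 0 = 0 := Subtype.ext (sub_self _)

lemma Ys_zero : Ys 0 = 0 := Subtype.ext (sub_self _)

lemma gammaL_zero_tpow (lam : ℂ) (σ : SuperRep tSub V) (k : ℤ) (u : V) :
    gammaL lam σ 0 (tpow k ⊗ₜ u) = (lam + k) • (tpow k ⊗ₜ u) := by
  simp [gammaL_tpow, Xs_zero]

lemma gammaL_zero_opow (lam : ℂ) (σ : SuperRep tSub V) (k : ℤ) (u : V) :
    gammaL lam σ 0 (opow k ⊗ₜ u) = (lam + k) • (opow k ⊗ₜ u) := by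
  simp [gammaL_opow, Xs_zero]

lemma mem_of_tmul_mem {P : Submodule ℂ (A ⊗[ℂ] V)} (h0 : ∀ k u, tpow k ⊗ₜ u ∈ P)
    (h1 : ∀ k u, opow k ⊗ₜ u ∈ P) (x : A ⊗[ℂ] V) : x ∈ P := by
  rw [← Submodule.Quotient.mk_eq_zero]
  have : P.mkQ = 0 := AV_ext (fun k u => by simpa using h0 k u) (fun k u => by simpa using h1 k u)
  exact LinearMap.congr_fun this x

lemma isWeight_Gamma (lam : ℂ) (σ : SuperRep tSub V) : IsWeight (Gamma lam σ) := by
  rw [IsWeight, Gamma_L, eq_top_iff]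
  refine fun x _ => mem_of_tmul_mem (fun k u => ?_) (fun k u => ?_) x <;>
  refine Submodule.mem_iSup_of_mem (lam + k) (Module.End.mem_eigenspace_iff.2 ?_)
  · exact gammaL_zero_tpow lam σ k u
  · exact gammaL_zero_opow lam σ k u

variable (V) in
/-- The coefficients of `t^k` and of `t^k ξ` of an element of `A ⊗ V`. -/
def coeffs : A ⊗[ℂ] V →ₗ[ℂ] (ℤ →₀ V × V) := TensorProduct.lift
  (laurentLift (fun k => Finsupp.lsingle k ∘ₗ LinearMap.inl ℂ V V) ∘ₗ
      (TrivSqZeroExt.fstHom ℂ ℂ[T;T⁻¹] ℂ[T;T⁻¹]).toLinearMap +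
    laurentLift (fun k => Finsupp.lsingle k ∘ₗ LinearMap.inr ℂ V V) ∘ₗ
      (TrivSqZeroExt.sndHom ℂ[T;T⁻¹] ℂ[T;T⁻¹]).restrictScalars ℂ)

lemma coeffs_tpow (k : ℤ) (u : V) : coeffs V (tpow k ⊗ₜ u) = Finsupp.single k (u, 0) := by
  simp [coeffs, tpow, laurentLift_T]

lemma coeffs_opow (k : ℤ) (u : V) : coeffs V (opow k ⊗ₜ u) = Finsupp.single k (0, u) := by
  simp [coeffs, opow_eq, laurentLift_T]

variable (V) in
/-- The element of `A ⊗ V` with given coefficients. -/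
def ofCoeffs : (ℤ →₀ V × V) →ₗ[ℂ] A ⊗[ℂ] V := Finsupp.lsum ℂ fun k =>
  LinearMap.coprod (TensorProduct.mk ℂ A V (tpow k)) (TensorProduct.mk ℂ A V (opow k))

lemma ofCoeffs_single (k : ℤ) (w : V × V) :
    ofCoeffs V (Finsupp.single k w) = tpow k ⊗ₜ w.1 + opow k ⊗ₜ w.2 := by
  simp [ofCoeffs]

lemma ofCoeffs_coeffs (x : A ⊗[ℂ] V) : ofCoeffs V (coeffs V x) = x := by
  have : ofCoeffs V ∘ₗ coeffs V = LinearMap.id :=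
    AV_ext (fun k u => by simp [coeffs_tpow, ofCoeffs_single])
      (fun k u => by simp [coeffs_opow, ofCoeffs_single])
  exact LinearMap.congr_fun this x

/-- The degree-`j` component is exactly the weight space of weight `λ + j`, and different degrees
have different weights. -/
lemma coeffs_gammaL_zero (lam : ℂ) (σ : SuperRep tSub V) (x : A ⊗[ℂ] V) (j : ℤ) :
    coeffs V (gammaL lam σ 0 x) j = (lam + j) • coeffs V x j := by
  have : Finsupp.lapply j ∘ₗ coeffs V ∘ₗ gammaL lam σ 0 =
      (lam + j) • (Finsupp.lapply j ∘ₗ coeffs V) := by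
    refine AV_ext (fun k u => ?_) (fun k u => ?_)
    · simp only [LinearMap.comp_apply, gammaL_zero_tpow, map_smul, LinearMap.smul_apply,
        coeffs_tpow, Finsupp.lapply_apply]
      by_cases h : k = j <;> simp [Finsupp.single_apply, h]
    · simp only [LinearMap.comp_apply, gammaL_zero_opow, map_smul, LinearMap.smul_apply,
        coeffs_opow, Finsupp.lapply_apply]
      by_cases h : k = j <;> simp [Finsupp.single_apply, h]
  exact LinearMap.congr_fun this x

/-- A nonzero subspace stable under `L_0` contains a nonzero weight vector. -/
lemma exists_weight_vector (lam : ℂ) (σ : SuperRep tSub V) {N : Submodule ℂ (A ⊗[ℂ] V)}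
    (hN : ∀ x ∈ N, gammaL lam σ 0 x ∈ N) (hne : N ≠ ⊥) :
    ∃ (k : ℤ) (u v : V), tpow k ⊗ₜ u + opow k ⊗ₜ v ∈ N ∧ (u ≠ 0 ∨ v ≠ 0) := by
  obtain ⟨x, hx, hx0⟩ := N.ne_bot_iff.1 hne
  -- Induction on the number of `t`-degrees that occur in `x`.
  induction h : (coeffs V x).support.card using Nat.strong_induction_on generalizing x with
  | _ n ih =>
  have hc : coeffs V x ≠ 0 := fun h0 => hx0 (by rw [← ofCoeffs_coeffs x, h0, map_zero])
  obtain ⟨k, hk⟩ := Finsupp.support_nonempty_iff.2 hc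
  -- This multiplies the degree-`j` coefficient by `j - k`: degree `k` disappears and no new degree
  -- appears. If the result is zero, `x` was concentrated in degree `k`.
  set y := gammaL lam σ 0 x - (lam + k) • x with hy
  have hyN : y ∈ N := sub_mem (hN x hx) (N.smul_mem _ hx)
  have hyc (j : ℤ) : coeffs V y j = ((j : ℂ) - k) • coeffs V x j := by
    rw [hy, map_sub, map_smul, Finsupp.sub_apply, Finsupp.smul_apply, coeffs_gammaL_zero]
    module
  by_cases hy0 : y = 0
  · have hs : coeffs V x = Finsupp.single k (coeffs V x k) := by
      ext1 j
      by_cases hj : k = j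
      · simp [hj]
      · have h1 := hyc j
        rw [hy0, map_zero, Finsupp.zero_apply, eq_comm, smul_eq_zero, sub_eq_zero,
          Int.cast_inj] at h1
        rw [Finsupp.single_apply, if_neg hj]
        exact h1.resolve_left (Ne.symm hj)
    refine ⟨k, (coeffs V x k).1, (coeffs V x k).2, ?_, ?_⟩
    · rw [← ofCoeffs_single, ← hs, ofCoeffs_coeffs]; exact hx
    · by_contra! h0
      exact (Finsupp.mem_support_iff.1 hk) (Prod.ext h0.1 h0.2)
  · refine ih _ ?_ y hyN hy0 rfl
    rw [← h]
    refine Finset.card_lt_card (Finset.ssubset_iff_of_subset (fun j hj => ?_) |>.2 ⟨k, hk, ?_⟩)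
    · rw [Finsupp.mem_support_iff, hyc] at hj
      exact Finsupp.mem_support_iff.2 (right_ne_zero_of_smul hj)
    · simp [Finsupp.mem_support_iff, hyc]

/-- A nonzero subspace stable under `L_0` and `t⁻¹` contains a nonzero `1 ⊗ u + ξ ⊗ v`. -/
lemma exists_weight_vector_zero (lam : ℂ) (σ : SuperRep tSub V) {N : Submodule ℂ (A ⊗[ℂ] V)}
    (hN : ∀ x ∈ N, gammaL lam σ 0 x ∈ N)
    (ht : ∀ k, ∀ x ∈ N, LinearMap.rTensor V (LinearMap.mulLeft ℂ (tpow k)) x ∈ N)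
    (hne : N ≠ ⊥) :
    ∃ u v : V, tpow 0 ⊗ₜ u + opow 0 ⊗ₜ v ∈ N ∧ (u ≠ 0 ∨ v ≠ 0) := by
  obtain ⟨k, u, v, h, h0⟩ := exists_weight_vector lam σ hN hne
  refine ⟨u, v, ?_, h0⟩
  simpa [tpow_mul_tpow, tpow_mul_opow] using ht (-k) _ h

lemma tmul_ne_zero_left {u : V} (hu : u ≠ 0) : tpow 0 ⊗ₜ[ℂ] u ≠ 0 := fun h => by
  simpa [coeffs_tpow, hu] using congrArg (coeffs V) h

/-- The subspace `W` below consists of the `u` with `1 ⊗ u ∈ N`. It is also the set of `u` with `ξ ⊗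
u ∈ N`, and powers of `t` move between degrees, so `W = V` forces `N` to be everything. -/
lemma isSimple_Gamma (lam : ℂ) (σ : SuperRep tSub V) (hσ : σ.IsSimple) :
    (Gamma lam σ).IsSimple := by
  obtain ⟨hnt, hs⟩ := hσ
  obtain ⟨w, hw⟩ := exists_ne (0 : V)
  refine ⟨⟨tpow 0 ⊗ₜ w, 0, tmul_ne_zero_left hw⟩, fun N hN => or_iff_not_imp_left.2 fun hne => ?_⟩
  obtain ⟨hgr, hst⟩ := hN
  have hL (m : ℤ) : ∀ x ∈ N, gammaL lam σ m x ∈ N := fun x hx => by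
    simpa only [Gamma_L] using hst (L m, 0) x hx
  have hG (m : ℤ) : ∀ x ∈ N, gammaG lam σ m x ∈ N := fun x hx => by
    simpa only [Gamma_G] using hst (G m, 0) x hx
  have hA (a : A) : ∀ x ∈ N, LinearMap.rTensor V (LinearMap.mulLeft ℂ a) x ∈ N := fun x hx => by
    simpa only [Gamma_A] using hst (0, a) x hx
  obtain ⟨u, v, huv, h0⟩ := exists_weight_vector_zero lam σ (hL 0) (fun k => hA (tpow k)) hne
  let W : Submodule ℂ V := N.comap (TensorProduct.mk ℂ A V (tpow 0))
  have hWo {u : V} (k : ℤ) (hu : u ∈ W) : opow k ⊗ₜ u ∈ N := by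
    simpa [opow_mul_tpow] using hA (opow k) _ hu
  have hWt {u : V} (k : ℤ) (hu : u ∈ W) : tpow k ⊗ₜ u ∈ N := by
    simpa [tpow_mul_tpow] using hA (tpow k) _ hu
  have ht_of {u : V} {k : ℤ} (hu : tpow k ⊗ₜ u ∈ N) : u ∈ W := by
    have h := hA (tpow (-k)) _ hu
    rwa [mul_act_tpow, neg_add_cancel] at h
  -- Shift to degree `0` and apply `G_0`: since `Y_0 = 0`, it sends `ξ ⊗ u` to `-1 ⊗ u`.
  have ho_of {u : V} {k : ℤ} (hu : opow k ⊗ₜ u ∈ N) : u ∈ W := by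
    have h := hG (-k) _ hu
    have h' := hG 0 _ (hA (tpow (-k)) _ hu)
    rw [mul_act_tpow', gammaG_opow, Ys_zero] at h'
    simpa [W] using h'
  have hW0 : W ≠ ⊥ := by
    rw [Submodule.ne_bot_iff]
    -- If `u ≠ 0`, multiplication by `ξ` removes the `v` term and leaves `ξ ⊗ u`; otherwise the
    -- vector already is `ξ ⊗ v`.
    by_cases hu : u = 0
    · refine ⟨v, ho_of (k := 0) ?_, h0.resolve_left (not_not.2 hu)⟩
      simpa [hu] using huv
    · refine ⟨u, ho_of (k := 0) ?_, hu⟩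
      simpa [opow_mul_tpow, opow_mul_opow] using hA (opow 0) _ huv
  have hWs : σ.IsSubmodule W := by
    refine ⟨isGraded_of_mem fun a ha b hb hab => ?_, ?_⟩
    · have hab' : tpow 0 ⊗ₜ[ℂ] a + tpow 0 ⊗ₜ[ℂ] b ∈ N := by
        rw [← TensorProduct.tmul_add]; exact hab
      exact (IsGraded.mem hgr (tmul_mem_tensorPart (tpow_mem 0) ha (by decide))
        (tmul_mem_tensorPart (tpow_mem 0) hb (by decide)) hab').1
    -- Stability is tested on `ξ ⊗ u`, where each of `L_n` and `G_n` involves only one operator of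
    -- `V`; the remaining term is known to lie in `N` and can be cancelled.
    · refine mem_of_tSub_generators (P := preserver σ.act W) (fun n u hu => ?_) (fun n u hu => ?_)
      · have h := hL n _ (hWo 0 hu)
        rw [gammaL_opow] at h
        exact ho_of ((Submodule.add_mem_iff_left N (N.smul_mem _ (hWo _ hu))).1 h)
      · have h := hG n _ (hWo 0 hu)
        rw [gammaG_opow] at h
        exact ho_of (neg_mem_iff.1 ((Submodule.sub_mem_iff_left N (hWt _ hu)).1 h))
  have hWtop := (hs W hWs).resolve_left hW0
  have hmem (u : V) : u ∈ W := hWtop ▸ Submodule.mem_top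
  rw [eq_top_iff]
  exact fun x _ => mem_of_tmul_mem (fun k u => hWt k (hmem u)) (fun k u => hWo k (hmem u)) x

/-- If `Γ(λ, V)` is simple then so is `V`. -/
lemma isSimple_of_Gamma (lam : ℂ) (σ : SuperRep tSub V) (h : (Gamma lam σ).IsSimple) :
    σ.IsSimple := by
  obtain ⟨hnt, hs⟩ := h
  have hV : Nontrivial V := by
    by_contra hV
    rw [not_nontrivial_iff_subsingleton] at hV
    exact not_subsingleton (A ⊗[ℂ] V) inferInstance
  refine ⟨hV, fun W hW => ?_⟩
  obtain ⟨hgr, hst⟩ := hW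
  -- `N` is the image of `A ⊗ W`, stable because every term of the action formulas applies an
  -- element of `A`-endomorphisms on the left and an operator preserving `W` on the right.
  let N : Submodule ℂ (A ⊗[ℂ] V) := LinearMap.range (LinearMap.lTensor A W.subtype)
  have hmem (a : A) {u : V} (hu : u ∈ W) : a ⊗ₜ u ∈ N := ⟨a ⊗ₜ ⟨u, hu⟩, by simp⟩
  have hle {Q : Submodule ℂ (A ⊗[ℂ] V)} (h0 : ∀ k, ∀ u ∈ W, tpow k ⊗ₜ u ∈ Q)
      (h1 : ∀ k, ∀ u ∈ W, opow k ⊗ₜ u ∈ Q) : N ≤ Q := by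
    rintro _ ⟨y, rfl⟩
    have : Q.mkQ ∘ₗ LinearMap.lTensor A W.subtype = 0 :=
      AV_ext (fun k u => by simpa using h0 k u u.2) (fun k u => by simpa using h1 k u u.2)
    simpa using LinearMap.congr_fun this y
  have hN : (Gamma lam σ).IsSubmodule N := by
    refine ⟨le_antisymm (hle (fun k u hu => ?_) (fun k u hu => ?_))
      (sup_le inf_le_left inf_le_left), ?_⟩
    · rw [hgr] at hu
      obtain ⟨a, ha, b, hb, rfl⟩ := Submodule.mem_sup.1 hu
      rw [TensorProduct.tmul_add]
      exact Submodule.add_mem_sup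
        ⟨hmem _ ha.1, tmul_mem_tensorPart (tpow_mem k) ha.2 (by decide)⟩
        ⟨hmem _ hb.1, tmul_mem_tensorPart (tpow_mem k) hb.2 (by decide)⟩
    · rw [hgr] at hu
      obtain ⟨a, ha, b, hb, rfl⟩ := Submodule.mem_sup.1 hu
      rw [TensorProduct.tmul_add, add_comm]
      exact Submodule.add_mem_sup
        ⟨hmem _ hb.1, tmul_mem_tensorPart (opow_mem k) hb.2 (by decide)⟩
        ⟨hmem _ ha.1, tmul_mem_tensorPart (opow_mem k) ha.2 (by decide)⟩
    · refine mem_of_generators (P := preserver (Gamma lam σ).act N) (fun n => ?_) (fun n => ?_)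
        (fun n => ?_) (fun n => ?_)
      · change N ≤ N.comap _
        rw [Gamma_L]
        refine hle (fun k u hu => ?_) (fun k u hu => ?_) <;> rw [Submodule.mem_comap]
        · rw [gammaL_tpow]
          exact add_mem (sub_mem (hmem _ (hst _ _ hu)) (N.smul_mem _ (hmem _ (hst _ _ hu))))
            (N.smul_mem _ (hmem _ hu))
        · rw [gammaL_opow]
          exact add_mem (hmem _ (hst _ _ hu)) (N.smul_mem _ (hmem _ hu))
      · change N ≤ N.comap _
        rw [Gamma_G]
        refine hle (fun k u hu => ?_) (fun k u hu => ?_) <;> rw [Submodule.mem_comap]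
        · rw [gammaG_tpow]
          exact add_mem (add_mem (hmem _ (hst _ _ hu)) (N.smul_mem _ (hmem _ (hst _ _ hu))))
            (N.smul_mem _ (hmem _ hu))
        · rw [gammaG_opow]
          exact sub_mem (neg_mem (hmem _ (hst _ _ hu))) (hmem _ hu)
      · change N ≤ N.comap _
        rw [Gamma_A]
        exact hle (fun k u hu => hmem _ hu) (fun k u hu => hmem _ hu)
      · change N ≤ N.comap _
        rw [Gamma_A]
        exact hle (fun k u hu => hmem _ hu) (fun k u hu => hmem _ hu)
  obtain hN | hN := hs N hN
  · refine Or.inl ((Submodule.eq_bot_iff W).2 fun u hu => ?_)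
    by_contra h0
    exact tmul_ne_zero_left h0 ((Submodule.eq_bot_iff N).1 hN _ (hmem (tpow 0) hu))
  · refine Or.inr (eq_top_iff.2 fun u _ => ?_)
    have hu : tpow 0 ⊗ₜ u ∈ N := hN ▸ Submodule.mem_top
    obtain ⟨y, hy⟩ := hu
    -- Taking the coefficient of `t^0` maps `N` into `W` and `1 ⊗ u` to `u`, so `N = ⊤` gives `W =
    -- ⊤`.
    let c : A ⊗[ℂ] V →ₗ[ℂ] V := LinearMap.fst ℂ V V ∘ₗ Finsupp.lapply 0 ∘ₗ coeffs V
    have hc : W.mkQ ∘ₗ c ∘ₗ LinearMap.lTensor A W.subtype = 0 := by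
      refine AV_ext (fun k u => ?_) (fun k u => ?_)
      · by_cases hk : k = 0 <;> simp [c, coeffs_tpow, Finsupp.single_apply, hk]
      · by_cases hk : k = 0 <;> simp [c, coeffs_opow, Finsupp.single_apply, hk]
    have h1 := LinearMap.congr_fun hc y
    rw [LinearMap.comp_apply, LinearMap.comp_apply, hy] at h1
    simpa [c, coeffs_tpow] using h1

end

/-! ### The relations in an `A s̄`-module -/

section

variable {M : Type*} [AddCommGroup M] [Module ℂ M] [SuperSpace M] (ρ : SuperRep STilde M)

lemma L_mem (m : ℤ) : ((L m, 0) : STilde) ∈ part (V := STilde) 0 :=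
  mem_St.2 ⟨mem_S_zero.2 rfl, zero_mem _⟩

lemma G_mem (m : ℤ) : ((G m, 0) : STilde) ∈ part (V := STilde) 1 :=
  mem_St.2 ⟨mem_S_one.2 rfl, zero_mem _⟩

lemma A_mem {i : ZMod 2} {a : A} (ha : a ∈ part (V := A) i) :
    ((0, a) : STilde) ∈ part (V := STilde) i :=
  mem_St.2 ⟨zero_mem _, ha⟩

lemma act_S_smul (c : ℂ) (x : SBar) : ρ.act (c • x, 0) = c • ρ.act (x, 0) := by
  rw [← map_smul]; simp

lemma act_A_smul (c : ℂ) (a : A) : ρ.act (0, c • a) = c • ρ.act (0, a) := by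
  rw [← map_smul]; simp

lemma act_A_neg (a : A) : ρ.act (0, -a) = -ρ.act (0, a) := by
  rw [← map_neg]; simp

/-- This and the following relations are the super bracket identities in the form of exchange rules.
The mixed ones move elements of `A` to the left of `L` and `G`, which brings all later computations
to a normal form. -/
lemma act_L_L (m n : ℤ) (v : M) : ρ.act (L m, 0) (ρ.act (L n, 0) v) =
    ρ.act (L n, 0) (ρ.act (L m, 0) v) + ((n : ℂ) - m) • ρ.act (L (m + n), 0) v := by
  have h : ρ.act (stBracket (L m, 0) (L n, 0)) = _ := ρ.act_sbr 0 0 _ _ (L_mem m) (L_mem n)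
  rw [stBracket_S_S, sBracket_L_L, act_S_smul, koszul_zero_left, one_smul] at h
  have := LinearMap.congr_fun h v
  simp only [LinearMap.smul_apply, LinearMap.sub_apply, Module.End.mul_apply] at this
  rw [this]; abel

lemma act_L_G (m n : ℤ) (v : M) : ρ.act (L m, 0) (ρ.act (G n, 0) v) =
    ρ.act (G n, 0) (ρ.act (L m, 0) v) + ((n : ℂ) - m / 2) • ρ.act (G (n + m), 0) v := by
  have h : ρ.act (stBracket (L m, 0) (G n, 0)) = _ := ρ.act_sbr 0 1 _ _ (L_mem m) (G_mem n)
  rw [stBracket_S_S, sBracket_L_G, act_S_smul, koszul_zero_left, one_smul] at h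
  have := LinearMap.congr_fun h v
  simp only [LinearMap.smul_apply, LinearMap.sub_apply, Module.End.mul_apply] at this
  rw [this]; abel

lemma act_G_G (m n : ℤ) (v : M) : ρ.act (G m, 0) (ρ.act (G n, 0) v) =
    -ρ.act (G n, 0) (ρ.act (G m, 0) v) + (-2 : ℂ) • ρ.act (L (m + n), 0) v := by
  have h : ρ.act (stBracket (G m, 0) (G n, 0)) = _ := ρ.act_sbr 1 1 _ _ (G_mem m) (G_mem n)
  rw [stBracket_S_S, sBracket_G_G, act_S_smul, koszul_one_one] at h
  have := LinearMap.congr_fun h v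
  simp only [LinearMap.smul_apply, LinearMap.sub_apply, Module.End.mul_apply] at this
  rw [this]; module

lemma act_L_tpow (m n : ℤ) (v : M) : ρ.act (L m, 0) (ρ.act (0, tpow n) v) =
    ρ.act (0, tpow n) (ρ.act (L m, 0) v) + (n : ℂ) • ρ.act (0, tpow (m + n)) v := by
  have h : ρ.act (stBracket (L m, 0) (0, tpow n)) = _ :=
    ρ.act_sbr 0 0 _ _ (L_mem m) (A_mem (tpow_mem n))
  rw [stBracket_S_A, actA_L_tpow, act_A_smul, koszul_zero_left, one_smul] at h
  have := LinearMap.congr_fun h v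
  simp only [LinearMap.smul_apply, LinearMap.sub_apply, Module.End.mul_apply] at this
  rw [this]; abel

lemma act_G_tpow (m n : ℤ) (v : M) : ρ.act (G m, 0) (ρ.act (0, tpow n) v) =
    ρ.act (0, tpow n) (ρ.act (G m, 0) v) + (n : ℂ) • ρ.act (0, opow (m + n)) v := by
  have h : ρ.act (stBracket (G m, 0) (0, tpow n)) = _ :=
    ρ.act_sbr 1 0 _ _ (G_mem m) (A_mem (tpow_mem n))
  rw [stBracket_S_A, actA_G_tpow, act_A_smul, koszul_zero_right, one_smul] at h
  have := LinearMap.congr_fun h v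
  simp only [LinearMap.smul_apply, LinearMap.sub_apply, Module.End.mul_apply] at this
  rw [this]; abel

lemma act_L_opow (m n : ℤ) (v : M) : ρ.act (L m, 0) (ρ.act (0, opow n) v) =
    ρ.act (0, opow n) (ρ.act (L m, 0) v) + ((n : ℂ) + m / 2) • ρ.act (0, opow (m + n)) v := by
  have h : ρ.act (stBracket (L m, 0) (0, opow n)) = _ :=
    ρ.act_sbr 0 1 _ _ (L_mem m) (A_mem (opow_mem n))
  rw [stBracket_S_A, actA_L_opow, act_A_smul, koszul_zero_left, one_smul] at h
  have := LinearMap.congr_fun h v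
  simp only [LinearMap.smul_apply, LinearMap.sub_apply, Module.End.mul_apply] at this
  rw [this]; abel

lemma act_G_opow (m n : ℤ) (v : M) : ρ.act (G m, 0) (ρ.act (0, opow n) v) =
    -ρ.act (0, opow n) (ρ.act (G m, 0) v) - ρ.act (0, tpow (m + n)) v := by
  have h : ρ.act (stBracket (G m, 0) (0, opow n)) = _ :=
    ρ.act_sbr 1 1 _ _ (G_mem m) (A_mem (opow_mem n))
  rw [stBracket_S_A, actA_G_opow, act_A_neg, koszul_one_one] at h
  have := LinearMap.congr_fun h v
  simp only [LinearMap.smul_apply, LinearMap.sub_apply, LinearMap.neg_apply,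
    Module.End.mul_apply] at this
  rw [sub_eq_add_neg, this]; module

variable {ρ}

/-! ### Products of elements of `A` acting on the module -/

lemma IsAssoc.mul_apply (hρ : IsAssoc ρ) (a b : A) (v : M) :
    ρ.act (0, a) (ρ.act (0, b) v) = ρ.act (0, a * b) v := by
  rw [hρ.2]; rfl

lemma IsAssoc.one_apply (hρ : IsAssoc ρ) (v : M) : ρ.act (0, 1) v = v := by
  rw [hρ.1]; rfl

lemma tpow_zero : tpow 0 = 1 := by simp [tpow]

lemma IsAssoc.tpow_zero_apply (hρ : IsAssoc ρ) (v : M) : ρ.act (0, tpow 0) v = v := by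
  rw [tpow_zero, hρ.one_apply]

lemma IsAssoc.tpow_tpow (hρ : IsAssoc ρ) (m n : ℤ) (v : M) :
    ρ.act (0, tpow m) (ρ.act (0, tpow n) v) = ρ.act (0, tpow (m + n)) v := by
  rw [hρ.mul_apply, tpow_mul_tpow]

lemma IsAssoc.tpow_opow (hρ : IsAssoc ρ) (m n : ℤ) (v : M) :
    ρ.act (0, tpow m) (ρ.act (0, opow n) v) = ρ.act (0, opow (m + n)) v := by
  rw [hρ.mul_apply, tpow_mul_opow]

lemma IsAssoc.opow_tpow (hρ : IsAssoc ρ) (m n : ℤ) (v : M) :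
    ρ.act (0, opow m) (ρ.act (0, tpow n) v) = ρ.act (0, opow (m + n)) v := by
  rw [hρ.mul_apply, opow_mul_tpow]

lemma IsAssoc.opow_opow (hρ : IsAssoc ρ) (m n : ℤ) (v : M) :
    ρ.act (0, opow m) (ρ.act (0, opow n) v) = 0 := by
  rw [hρ.mul_apply, opow_mul_opow]
  exact LinearMap.congr_fun (map_zero ρ.act) v

/-! ### The `(t - 1) s̄`-module structure on the kernel of `ξ` in a weight space -/

variable (ρ) in
/-- The kernel of `ξ` in the weight space of weight `λ`. -/
def xiKer (lam : ℂ) : Submodule ℂ M :=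
  Module.End.eigenspace (ρ.act (L 0, 0)) lam ⊓ LinearMap.ker (ρ.act (0, opow 0))

lemma mem_xiKer {lam : ℂ} {v : M} : v ∈ xiKer ρ lam ↔
    ρ.act (L 0, 0) v = lam • v ∧ ρ.act (0, opow 0) v = 0 := by
  rw [xiKer, Submodule.mem_inf, Module.End.mem_eigenspace_iff, LinearMap.mem_ker]

lemma IsAssoc.opow_of_mem_xiKer (hρ : IsAssoc ρ) {lam : ℂ} {v : M} (hv : v ∈ xiKer ρ lam)
    (n : ℤ) : ρ.act (0, opow n) v = 0 := by
  rw [← add_zero n, ← hρ.tpow_opow, (mem_xiKer.1 hv).2, map_zero]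

lemma isGraded_eigenspace {f : Module.End ℂ M} (hf : HasParity 0 f) (μ : ℂ) :
    IsGraded (Module.End.eigenspace f μ) := by
  rw [Module.End.eigenspace_def]
  refine isGraded_ker (i := 0) fun j v hv => ?_
  have h := hf j v hv
  rw [zero_add] at h ⊢
  exact sub_mem h (Submodule.smul_mem _ μ hv)

lemma isGraded_xiKer (lam : ℂ) : IsGraded (xiKer ρ lam) :=
  (isGraded_eigenspace (fun j v hv => ρ.act_mem 0 j _ v (L_mem 0) hv) lam).inf
    (isGraded_ker (fun j v hv => ρ.act_mem 1 j _ v (A_mem (opow_mem 0)) hv))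

/-- The kernel of `ξ` in a weight space, with the parity reversed. -/
instance (lam : ℂ) : SuperSpace (xiKer ρ lam) where
  part i := (part (V := M) (i + 1)).comap (xiKer ρ lam).subtype
  isCompl := by
    rw [zero_add, one_add_one_parity]
    -- The shift by one exchanges the two parts, hence the complement relation is used in reversed
    -- order.
    refine IsCompl.symm ⟨?_, ?_⟩
    · rw [Submodule.disjoint_def]
      exact fun x h0 h1 => Subtype.ext
        ((Submodule.disjoint_def.1 (SuperSpace.isCompl (V := M)).disjoint) _ h0 h1)
    · rw [codisjoint_iff, eq_top_iff]
      rintro ⟨x, hx⟩ -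
      obtain ⟨a, ha, b, hb, rfl⟩ := exists_add_of_superSpace x
      obtain ⟨ha', hb'⟩ := (isGraded_xiKer lam).mem ha hb hx
      exact Submodule.mem_sup.2 ⟨⟨a, ha'⟩, ha, ⟨b, hb'⟩, hb, rfl⟩

variable (ρ) in
/-- The operator by which `f L_0 + g G_0 ∈ s̄` acts on the kernel of `ξ`: it sends `L_m` to
`t^(-m) L_m - m / 2` and `G_m` to `-t^(-m) G_m`. -/
def untwist : SBar →ₗ[ℂ] Module.End ℂ M :=
  laurentLift (fun m => ρ.act (0, tpow (-m)) * ρ.act (L m, 0) - ((m : ℂ) / 2) • 1) ∘ₗ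
      LinearMap.fst ℂ _ _ -
    laurentLift (fun m => ρ.act (0, tpow (-m)) * ρ.act (G m, 0)) ∘ₗ LinearMap.snd ℂ _ _

lemma IsAssoc.untwist_Xs (hρ : IsAssoc ρ) (m : ℤ) (v : M) : untwist ρ (Xs m) v =
    ρ.act (0, tpow (-m)) (ρ.act (L m, 0) v) - ρ.act (L 0, 0) v - ((m : ℂ) / 2) • v := by
  simp [untwist, Xs, L, laurentLift_T, hρ.tpow_zero_apply, -LaurentPolynomial.T_zero]
  abel

lemma IsAssoc.untwist_Ys (hρ : IsAssoc ρ) (m : ℤ) (v : M) : untwist ρ (Ys m) v =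
    ρ.act (G 0, 0) v - ρ.act (0, tpow (-m)) (ρ.act (G m, 0) v) := by
  simp [untwist, Ys, G, laurentLift_T, hρ.tpow_zero_apply, -LaurentPolynomial.T_zero]

/-- The operators `t^(-m) L_m` and `t^(-m) G_m` have weight `0`, so they preserve the weight space.
The first kind preserves `ker ξ` because `[L_m, ξ]` is a multiple of `t^m ξ`. The second does not,
but `ξ t^(-m) G_m v = -v` for every `m`, so the differences `G_0 - t^(-m) G_m` do. -/
lemma IsAssoc.untwist_mem (hρ : IsAssoc ρ) (lam : ℂ) (x : tSub) :
    ∀ v ∈ xiKer ρ lam, untwist ρ x v ∈ xiKer ρ lam := by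
  refine mem_of_tSub_generators
    (P := preserver (untwist ρ ∘ₗ tSub.subtype) (xiKer ρ lam)) (fun m v hv => ?_)
    (fun m v hv => ?_) x
  · change untwist ρ (Xs m) v ∈ xiKer ρ lam
    have hx := hρ.opow_of_mem_xiKer hv
    have hl := (mem_xiKer.1 hv).1
    have h2 := act_L_L ρ 0 m v
    have h3 := act_L_opow ρ m 0 v
    simp only [hx, hl, map_zero, map_smul, smul_zero, add_zero, zero_add] at h2 h3
    rw [mem_xiKer, hρ.untwist_Xs, hl]
    simp only [map_sub, map_smul, act_L_tpow, hρ.opow_tpow, hl, hx, h2, map_add]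
    refine ⟨?_, ?_⟩
    · simp only [zero_add]; push_cast; module
    · rw [← add_comm (-m) 0, ← hρ.tpow_opow, ← h3]; simp
  · change untwist ρ (Ys m) v ∈ xiKer ρ lam
    have hx := hρ.opow_of_mem_xiKer hv
    have hl := (mem_xiKer.1 hv).1
    have h2 (n : ℤ) := act_L_G ρ 0 n v
    have h3 (n : ℤ) := act_G_opow ρ n 0 v
    simp only [hx, hl, map_zero, map_smul, smul_zero, add_zero, zero_add] at h2 h3
    rw [mem_xiKer, hρ.untwist_Ys]
    simp only [map_sub, map_smul, act_L_tpow, hρ.opow_tpow, hl, hx, h2, map_add]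
    refine ⟨?_, ?_⟩
    · simp only [zero_add]; push_cast; module
    · have h4 (n : ℤ) : ρ.act (0, opow 0) (ρ.act (G n, 0) v) = -ρ.act (0, tpow n) v := by
        rw [← sub_eq_zero, ← neg_eq_zero, h3 n]; abel
      rw [← add_comm (-m) 0, ← hρ.tpow_opow, h4, h4, map_neg, hρ.tpow_tpow]; simp

/-! ### Relations between the operators on the kernel of `ξ` -/

lemma IsAssoc.opow_L (hρ : IsAssoc ρ) {lam : ℂ} {v : M} (hv : v ∈ xiKer ρ lam) (m n : ℤ) :
    ρ.act (0, opow n) (ρ.act (L m, 0) v) = 0 := by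
  simpa [hρ.opow_of_mem_xiKer hv, eq_comm] using act_L_opow ρ m n v

lemma IsAssoc.opow_G (hρ : IsAssoc ρ) {lam : ℂ} {v : M} (hv : v ∈ xiKer ρ lam) (m n : ℤ) :
    ρ.act (0, opow n) (ρ.act (G m, 0) v) = -ρ.act (0, tpow (m + n)) v := by
  have h := act_G_opow ρ m n v
  rw [hρ.opow_of_mem_xiKer hv, map_zero] at h
  rw [← sub_eq_zero, ← neg_eq_zero, h]; abel

/-- The exchange rule for `m = n` merely turns the product into its negative plus a term; halving `2
G_m^2 = -2 L_(2m)` gives a usable rewrite. -/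
lemma act_G_G_self (m : ℤ) (v : M) :
    ρ.act (G m, 0) (ρ.act (G m, 0) v) = -ρ.act (L (m + m), 0) v := by
  have h := act_G_G ρ m m v
  have h2 : (2 : ℂ) • ρ.act (G m, 0) (ρ.act (G m, 0) v) =
      (2 : ℂ) • -ρ.act (L (m + m), 0) v := by
    rw [two_smul]; nth_rewrite 1 [h]; module
  exact smul_right_injective M two_ne_zero h2

/-- The scalars `m/2` commute with everything and cancel on the right, because `(n - m)(m + n) - n^2
+ m^2 = 0`. Their value matters only for the intertwining property of `fromGamma`. -/
lemma IsAssoc.untwist_Xs_Xs (hρ : IsAssoc ρ) {lam : ℂ} {v : M} (hv : v ∈ xiKer ρ lam)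
    (m n : ℤ) : untwist ρ (Xs m) (untwist ρ (Xs n) v) = untwist ρ (Xs n) (untwist ρ (Xs m) v) +
      ((n : ℂ) - m) • untwist ρ (Xs (m + n)) v - (n : ℂ) • untwist ρ (Xs n) v +
      (m : ℂ) • untwist ρ (Xs m) v := by
  have hl := (mem_xiKer.1 hv).1
  simp only [hρ.untwist_Xs, map_sub, map_smul, map_add, act_L_tpow, hρ.tpow_tpow,
    act_L_L ρ 0 m, act_L_L ρ 0 n, act_L_L ρ m n, hl, neg_add_cancel_left, neg_add, zero_add,
    add_comm (-n) (-m)]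
  push_cast
  module

/-- Moving `G_n` past `t^(-m)` creates a multiple of some `t^k ξ`, which kills `L_m v` by `opow_L`.
-/
lemma IsAssoc.untwist_Xs_Ys (hρ : IsAssoc ρ) {lam : ℂ} {v : M} (hv : v ∈ xiKer ρ lam)
    (m n : ℤ) : untwist ρ (Xs m) (untwist ρ (Ys n) v) = untwist ρ (Ys n) (untwist ρ (Xs m) v) +
      ((n : ℂ) - m / 2) • untwist ρ (Ys (n + m)) v - (n : ℂ) • untwist ρ (Ys n) v +
      ((m : ℂ) / 2) • untwist ρ (Ys m) v := by
  have hl := (mem_xiKer.1 hv).1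
  simp only [hρ.untwist_Xs, hρ.untwist_Ys, map_sub, map_smul, map_add, act_L_tpow, act_G_tpow,
    hρ.tpow_tpow, hρ.tpow_opow, hρ.opow_L hv, act_L_G, hl, neg_add_cancel_left, neg_add, zero_add,
    add_zero, add_comm (-n) (-m), map_zero, smul_zero]
  push_cast
  module

/-- Here the `ξ` terms hit `G_n v` and contribute multiples of `v` by `opow_G`. In `Y_m Y_n v` they
come from `G_0 t^(-n) G_n` and `t^(-m) G_m t^(-n) G_n`, with opposite signs, and cancel. -/
lemma IsAssoc.untwist_Ys_Ys (hρ : IsAssoc ρ) {lam : ℂ} {v : M} (hv : v ∈ xiKer ρ lam)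
    (m n : ℤ) : untwist ρ (Ys m) (untwist ρ (Ys n) v) = -untwist ρ (Ys n) (untwist ρ (Ys m) v) +
      (2 : ℂ) • (untwist ρ (Xs m) v + untwist ρ (Xs n) v - untwist ρ (Xs (m + n)) v) := by
  have hl := (mem_xiKer.1 hv).1
  simp only [hρ.untwist_Xs, hρ.untwist_Ys, map_sub, map_smul, map_add, map_neg, act_G_tpow,
    hρ.tpow_tpow, hρ.tpow_opow, hρ.opow_G hv, act_G_G_self, act_G_G ρ 0 m, act_G_G ρ 0 n,
    act_G_G ρ m n, hl, neg_add_cancel_left, add_neg_cancel, neg_add, zero_add,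
    add_zero, add_comm (-n) (-m), hρ.tpow_zero_apply, neg_add_cancel,
    add_neg_cancel_comm_assoc]
  push_cast
  module

/-- The representation of `(t - 1) s̄` on the kernel of `ξ` in a weight space. -/
def xiKerRep (hρ : IsAssoc ρ) (lam : ℂ) : SuperRep tSub (xiKer ρ lam) where
  act :=
    { toFun x := (untwist ρ x).restrict (hρ.untwist_mem lam x)
      map_add' x y := LinearMap.ext fun v => Subtype.ext (by simp)
      map_smul' c x := LinearMap.ext fun v => Subtype.ext (by simp) }
  act_mem i j x v hx hv := by
    have hlin : ∀ w ∈ part (V := M) (j + 1), ∀ x : tSub, x ∈ part i →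
        untwist ρ x w ∈ part (V := M) (i + (j + 1)) := by
      intro w hw x hx
      have h := mem_span_tSubBasis hx
      clear hx
      induction h using Submodule.span_induction with
      | zero => simp
      | add x y _ _ h h' =>
        rw [Submodule.coe_add, map_add]
        exact add_mem h h'
      | smul c x _ h =>
        rw [Submodule.coe_smul, map_smul]
        exact Submodule.smul_mem _ c h
      | mem x h =>
        have hmem {i j : ZMod 2} {y : STilde} {w : M} (hy : y ∈ part (V := STilde) i)
          (hw : w ∈ part (V := M) j) := ρ.act_mem i j y w hy hw
        obtain rfl | rfl := parity_cases i <;> obtain ⟨m, rfl⟩ := h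
        · have h1 := hmem (A_mem (tpow_mem (-m))) (hmem (L_mem m) hw)
          have h2 := hmem (L_mem 0) hw
          simp only [zero_add] at h1 h2 ⊢
          rw [hρ.untwist_Xs]
          exact sub_mem (sub_mem h1 h2) (Submodule.smul_mem _ _ hw)
        · have h1 := hmem (A_mem (tpow_mem (-m))) (hmem (G_mem m) hw)
          rw [zero_add] at h1
          rw [hρ.untwist_Ys]
          exact sub_mem (hmem (G_mem 0) hw) h1
    change untwist ρ x v ∈ part (V := M) (i + j + 1)
    -- A vector of parity `j` in the kernel of `ξ` has parity `j + 1` in `M`.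
    rw [add_assoc]
    exact hlin v hv x hx
  act_sbr i j x y hx hy := by
    refine LinearMap.ext fun v => Subtype.ext ?_
    obtain ⟨v, hv⟩ := v
    change untwist ρ (sBracket x y) v = untwist ρ x (untwist ρ y v) -
      koszul i j • untwist ρ y (untwist ρ x v)
    -- For fixed parities and fixed `v`, the defect of the bracket identity is bilinear, so it
    -- suffices that it vanishes on pairs of `X`s and `Y`s.
    let B : tSub →ₗ[ℂ] tSub →ₗ[ℂ] M := LinearMap.mk₂ ℂ
      (fun x y => untwist ρ (sBracket x y) v - (untwist ρ x (untwist ρ y v) -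
        koszul i j • untwist ρ y (untwist ρ x v)))
      (fun x x' y => by
        simp only [Submodule.coe_add, map_add, LinearMap.add_apply, smul_add]; abel)
      (fun c x y => by
        simp only [Submodule.coe_smul, map_smul, LinearMap.smul_apply]; module)
      (fun x y y' => by
        simp only [Submodule.coe_add, map_add, LinearMap.add_apply, smul_add]; abel)
      (fun c x y => by
        simp only [Submodule.coe_smul, map_smul, LinearMap.smul_apply]; module)
    suffices h : B x y ∈ (⊥ : Submodule ℂ M) from sub_eq_zero.1 ((Submodule.mem_bot ℂ).1 h)
    refine LinearMap.BilinMap.apply_apply_mem_of_mem_span ⊥ (tSubBasis i) (tSubBasis j) B ?_ x y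
      (mem_span_tSubBasis hx) (mem_span_tSubBasis hy)
    clear hx hy x y
    intro x hx y hy
    rw [Submodule.mem_bot]
    change untwist ρ (sbr x y : tSub) v - (untwist ρ x (untwist ρ y v) -
      koszul i j • untwist ρ y (untwist ρ x v)) = 0
    obtain rfl | rfl := parity_cases i <;> obtain rfl | rfl := parity_cases j <;>
      obtain ⟨m, rfl⟩ := hx <;> obtain ⟨n, rfl⟩ := hy
    · rw [hρ.untwist_Xs_Xs hv, sbr_Xs_Xs, koszul_zero_left]
      simp only [Submodule.coe_add, Submodule.coe_sub, Submodule.coe_smul, map_add, map_sub,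
        map_smul, LinearMap.add_apply, LinearMap.sub_apply, LinearMap.smul_apply]
      module
    · rw [hρ.untwist_Xs_Ys hv, sbr_Xs_Ys, koszul_zero_left]
      simp only [Submodule.coe_add, Submodule.coe_sub, Submodule.coe_smul, map_add, map_sub,
        map_smul, LinearMap.add_apply, LinearMap.sub_apply, LinearMap.smul_apply]
      module
    · rw [hρ.untwist_Xs_Ys hv, sbr_skew 1 0 _ _ (Ys_mem m) (Xs_mem n), sbr_Xs_Ys,
        koszul_zero_right]
      simp only [Submodule.coe_add, Submodule.coe_sub, Submodule.coe_smul, Submodule.coe_neg,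
        map_add, map_sub, map_smul, map_neg, LinearMap.add_apply, LinearMap.sub_apply,
        LinearMap.smul_apply, LinearMap.neg_apply]
      module
    · rw [hρ.untwist_Ys_Ys hv, sbr_Ys_Ys, koszul_one_one]
      simp only [Submodule.coe_add, Submodule.coe_sub, Submodule.coe_smul, map_add, map_sub,
        map_smul, LinearMap.add_apply, LinearMap.sub_apply, LinearMap.smul_apply]
      module

/-! ### The isomorphism with `Γ(λ, V)` -/

variable (ρ) in
/-- The map `a ⊗ u ↦ -a G_0 u` from `A ⊗ V` to `M`, for `V` the kernel of `ξ` in a weight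
space. -/
def fromGamma (lam : ℂ) : A ⊗[ℂ] xiKer ρ lam →ₗ[ℂ] M :=
  -TensorProduct.lift (LinearMap.lcomp ℂ M (ρ.act (G 0, 0) ∘ₗ (xiKer ρ lam).subtype) ∘ₗ
    ρ.act ∘ₗ LinearMap.inr ℂ SBar A)

lemma fromGamma_tmul (lam : ℂ) (a : A) (u : xiKer ρ lam) :
    fromGamma ρ lam (a ⊗ₜ u) = -ρ.act (0, a) (ρ.act (G 0, 0) u) := by
  simp [fromGamma]

/-- From `ξ G_0 u = -u` on the kernel of `ξ`: the copy `ξ ⊗ V` is sent identically onto the kernel.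
-/
lemma IsAssoc.fromGamma_opow (hρ : IsAssoc ρ) (lam : ℂ) (k : ℤ) (u : xiKer ρ lam) :
    fromGamma ρ lam (opow k ⊗ₜ u) = ρ.act (0, tpow k) u := by
  rw [fromGamma_tmul, hρ.opow_G u.2, neg_neg, zero_add]

lemma coe_xiKerRep (hρ : IsAssoc ρ) (lam : ℂ) (x : tSub) (u : xiKer ρ lam) :
    ((xiKerRep hρ lam).act x u : M) = untwist ρ x u := rfl

/-- On `t^k ξ ⊗ u` the shift `-m/2` in the action of `X_m` cancels the `m/2` in `λ + k + m/2`. On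
`t^k ⊗ u` it combines with the `Y_m` term of the formula to give `[L_m, G_0] = -(m/2) G_m`. -/
lemma fromGamma_gammaL (hρ : IsAssoc ρ) (lam : ℂ) (m : ℤ) (z : A ⊗[ℂ] xiKer ρ lam) :
    fromGamma ρ lam (gammaL lam (xiKerRep hρ lam) m z) =
      ρ.act (L m, 0) (fromGamma ρ lam z) := by
  suffices h : fromGamma ρ lam ∘ₗ gammaL lam (xiKerRep hρ lam) m =
      ρ.act (L m, 0) ∘ₗ fromGamma ρ lam from LinearMap.congr_fun h z
  refine AV_ext (fun k u => ?_) (fun k u => ?_) <;>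
  have hl := (mem_xiKer.1 u.2).1 <;> simp only [LinearMap.comp_apply]
  · rw [gammaL_tpow]
    simp only [map_add, map_sub, map_smul, map_neg, fromGamma_tmul, hρ.fromGamma_opow,
      coe_xiKerRep, hρ.untwist_Xs, hρ.untwist_Ys, act_L_tpow, act_L_G ρ m 0, act_G_tpow,
      hρ.opow_L u.2, hl, hρ.tpow_tpow, hρ.tpow_opow, add_neg_cancel_comm, zero_add, map_zero,
      smul_zero]
    push_cast
    module
  · rw [gammaL_opow]
    simp only [map_add, map_sub, map_smul, map_neg, hρ.fromGamma_opow,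
      coe_xiKerRep, hρ.untwist_Xs, act_L_tpow, hl, hρ.tpow_tpow, add_neg_cancel_comm]
    module

lemma fromGamma_gammaG (hρ : IsAssoc ρ) (lam : ℂ) (m : ℤ) (z : A ⊗[ℂ] xiKer ρ lam) :
    fromGamma ρ lam (gammaG lam (xiKerRep hρ lam) m z) =
      ρ.act (G m, 0) (fromGamma ρ lam z) := by
  suffices h : fromGamma ρ lam ∘ₗ gammaG lam (xiKerRep hρ lam) m =
      ρ.act (G m, 0) ∘ₗ fromGamma ρ lam from LinearMap.congr_fun h z
  refine AV_ext (fun k u => ?_) (fun k u => ?_) <;>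
  have hl := (mem_xiKer.1 u.2).1 <;> simp only [LinearMap.comp_apply]
  · rw [gammaG_tpow]
    simp only [map_add, map_sub, map_smul, map_neg, fromGamma_tmul, hρ.fromGamma_opow,
      coe_xiKerRep, hρ.untwist_Xs, hρ.untwist_Ys, act_G_tpow, act_G_G_self,
      act_G_G ρ 0 m, hρ.opow_G u.2, hl, hρ.tpow_tpow, hρ.tpow_opow, add_neg_cancel_comm, zero_add,
      add_zero, add_neg_cancel, hρ.tpow_zero_apply]
    push_cast
    module
  · rw [gammaG_opow]
    simp only [map_add, map_sub, map_smul, map_neg, fromGamma_tmul, hρ.fromGamma_opow,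
      coe_xiKerRep, hρ.untwist_Ys, act_G_tpow, hρ.tpow_tpow, add_neg_cancel_comm,
      hρ.opow_of_mem_xiKer u.2]
    module

lemma fromGamma_act (hρ : IsAssoc ρ) (lam : ℂ) (x : STilde) (z : A ⊗[ℂ] xiKer ρ lam) :
    fromGamma ρ lam ((Gamma lam (xiKerRep hρ lam)).act x z) = ρ.act x (fromGamma ρ lam z) := by
  have hA (a : A) (z : A ⊗[ℂ] xiKer ρ lam) :
      fromGamma ρ lam ((Gamma lam (xiKerRep hρ lam)).act (0, a) z) =
        ρ.act (0, a) (fromGamma ρ lam z) := by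
    rw [Gamma_A]
    induction z with
    | zero => simp
    | add z z' h h' => simp only [map_add, h, h']
    | tmul b u =>
      rw [LinearMap.rTensor_tmul, LinearMap.mulLeft_apply, fromGamma_tmul, fromGamma_tmul,
        map_neg, hρ.mul_apply]
  let P : Submodule ℂ STilde :=
    { carrier := {x | ∀ z, fromGamma ρ lam ((Gamma lam (xiKerRep hρ lam)).act x z) =
        ρ.act x (fromGamma ρ lam z)}
      zero_mem' z := by simp
      add_mem' hx hy z := by simp only [map_add, LinearMap.add_apply, hx z, hy z]
      smul_mem' c x hx z := by simp only [map_smul, LinearMap.smul_apply, hx z] }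
  refine mem_of_generators (P := P) (fun n z => ?_) (fun n z => ?_) (fun n => hA _)
    (fun n => hA _) x z
  · rw [Gamma_L, fromGamma_gammaL]
  · rw [Gamma_G, fromGamma_gammaG]

/-! ### Parity and bijectivity of the comparison map -/

lemma hasParity_fromGamma (lam : ℂ) : HasParity 0 (fromGamma ρ lam) := by
  intro k
  rw [zero_add]
  change tensorPart A (xiKer ρ lam) k ≤ (part k).comap (fromGamma ρ lam)
  refine tensorPart_le fun i j hij a ha u hu => ?_
  rw [Submodule.mem_comap, fromGamma_tmul]
  have h := ρ.act_mem i _ _ _ (A_mem ha) (ρ.act_mem 1 (j + 1) _ _ (G_mem 0) hu)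
  -- The oddness of `G_0` compensates the reversed parity of the kernel of `ξ`, so the map is even.
  have e : i + (1 + (j + 1)) = k := by
    rw [← hij, add_comm j, ← add_assoc 1 1 j, one_add_one_parity, zero_add]
  rw [e] at h
  exact neg_mem h

/-- No simplicity is needed: the kernel is stable under `L_0` and the powers of `t`, so a nonzero
kernel would contain a nonzero `1 ⊗ u + ξ ⊗ v`, whose image is `-G_0 u + v`. -/
lemma injective_fromGamma (hρ : IsAssoc ρ) (lam : ℂ) :
    Function.Injective (fromGamma ρ lam) := by
  rw [← LinearMap.ker_eq_bot]
  by_contra hne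
  have hst (x : STilde) : ∀ z ∈ LinearMap.ker (fromGamma ρ lam),
      (Gamma lam (xiKerRep hρ lam)).act x z ∈ LinearMap.ker (fromGamma ρ lam) := fun z hz => by
    rw [LinearMap.mem_ker] at hz ⊢
    rw [fromGamma_act, hz, map_zero]
  obtain ⟨u, v, huv, h0⟩ := exists_weight_vector_zero lam (xiKerRep hρ lam)
    (fun z hz => by simpa only [Gamma_L] using hst (L 0, 0) z hz)
    (fun k z hz => by simpa only [Gamma_A] using hst (0, tpow k) z hz) hne
  rw [LinearMap.mem_ker, map_add, fromGamma_tmul, hρ.fromGamma_opow, hρ.tpow_zero_apply,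
    hρ.tpow_zero_apply] at huv
  have hu : u = 0 := by
    -- Applying `ξ` to `-G_0 u + v = 0` kills `v` and turns `-G_0 u` into `u`.
    have h := congrArg (ρ.act (0, opow 0)) huv
    rw [map_add, map_neg, hρ.opow_G u.2, (mem_xiKer.1 v.2).2, add_zero, zero_add, neg_neg,
      hρ.tpow_zero_apply, map_zero] at h
    exact Subtype.ext h
  have hv : v = 0 := by
    rw [hu] at huv
    exact Subtype.ext (by simpa using huv)
  exact h0.elim (· hu) (· hv)

/-- `ξ` commutes with `L_0` and squares to zero: for a nonzero weight vector `w`, either `w` or `ξ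
w` is the required vector. -/
lemma exists_ne_zero_mem_xiKer (hρ : IsAssoc ρ) {lam : ℂ} (hlam : lam ∈ support ρ) :
    ∃ v ∈ xiKer ρ lam, v ≠ 0 := by
  obtain ⟨w, hw, hw0⟩ := Submodule.exists_mem_ne_zero_of_ne_bot hlam
  rw [Module.End.mem_eigenspace_iff] at hw
  by_cases h : ρ.act (0, opow 0) w = 0
  · exact ⟨w, mem_xiKer.2 ⟨hw, h⟩, hw0⟩
  · refine ⟨_, mem_xiKer.2 ⟨?_, hρ.opow_opow 0 0 w⟩, h⟩
    rw [act_L_opow, hw]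
    simp

lemma surjective_fromGamma (hρ : IsAssoc ρ) (hs : ρ.IsSimple) {lam : ℂ}
    (hlam : lam ∈ support ρ) : Function.Surjective (fromGamma ρ lam) := by
  rw [← LinearMap.range_eq_top]
  refine (hs.2 _ ⟨isGraded_range (hasParity_fromGamma lam), ?_⟩).resolve_left fun h => ?_
  · rintro x _ ⟨z, rfl⟩
    exact ⟨_, fromGamma_act hρ lam x z⟩
  · obtain ⟨v, hv, hv0⟩ := exists_ne_zero_mem_xiKer hρ hlam
    refine hv0 ((Submodule.mem_bot ℂ).1 (h ▸ ⟨opow 0 ⊗ₜ ⟨v, hv⟩, ?_⟩))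
    rw [hρ.fromGamma_opow, hρ.tpow_zero_apply]

end

/-! ### Transport along isomorphisms -/

namespace SuperRep

variable {L : Type*} [AddCommGroup L] [Module ℂ L] [LieSuperalgebra L]
  {M : Type*} [AddCommGroup M] [Module ℂ M] [SuperSpace M]
  {M' : Type*} [AddCommGroup M'] [Module ℂ M'] [SuperSpace M']
  {ρ : SuperRep L M} {ρ' : SuperRep L M'}

/-- Parity preservation passes to the inverse because the homogeneous components of a vector are
unique. -/
lemma Iso.symm (h : ρ.Iso ρ') : ρ'.Iso ρ := by
  obtain ⟨e, hp, hact⟩ := h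
  refine ⟨e.symm, fun i v hv => ?_, fun x v => ?_⟩
  · obtain ⟨a, ha, b, hb, hab⟩ := exists_add_of_superSpace (e.symm v)
    have hv' : e a + e b = v := by rw [← map_add, hab, e.apply_symm_apply]
    obtain rfl | rfl := parity_cases i
    · have h := parts_unique (hp 0 a ha) (hp 1 b hb) hv (zero_mem _) (by rw [hv', add_zero])
      rwa [← h.1, e.symm_apply_apply]
    · have h := parts_unique (hp 0 a ha) (hp 1 b hb) (zero_mem _) hv (by rw [hv', zero_add])
      rwa [← h.2, e.symm_apply_apply]
  · rw [e.symm_apply_eq, hact, e.apply_symm_apply]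

lemma IsSimple.of_iso (hs : ρ.IsSimple) (h : ρ.Iso ρ') : ρ'.IsSimple := by
  obtain ⟨e, hp, hact⟩ := h
  obtain ⟨hnt, hs⟩ := hs
  refine ⟨e.symm.toEquiv.nontrivial, fun N hN => ?_⟩
  have hN' : ρ.IsSubmodule (N.comap e.toLinearMap) := by
    refine ⟨isGraded_of_mem fun a ha b hb hab => ?_, fun x v hv => ?_⟩
    · rw [Submodule.mem_comap, map_add] at hab
      exact (IsGraded.mem hN.1 (hp 0 a ha) (hp 1 b hb) hab).1
    · rw [Submodule.mem_comap] at hv ⊢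
      change e (ρ.act x v) ∈ N
      rw [hact]
      exact hN.2 x _ hv
  refine (hs _ hN').imp (fun h => ?_) (fun h => ?_)
  · rw [eq_bot_iff]
    intro w hw
    have : e.symm w ∈ N.comap e.toLinearMap := by simpa using hw
    rw [h, Submodule.mem_bot] at this
    simpa using this
  · rw [eq_top_iff]
    intro w _
    have : e.symm w ∈ N.comap e.toLinearMap := h ▸ Submodule.mem_top
    simpa using this

end SuperRep

/-- If every eigenspace vanished, their supremum would be `⊥`, contradicting diagonalizability on a
nonzero space. -/
lemma exists_mem_support {M : Type*} [AddCommGroup M] [Module ℂ M] [SuperSpace M] [Nontrivial M]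
    {ρ : SuperRep STilde M} (hw : IsWeight ρ) : (support ρ).Nonempty := by
  by_contra h
  have h0 : ∀ μ, Module.End.eigenspace (ρ.act (L 0, 0)) μ = ⊥ := fun μ =>
    by_contra fun hμ => h ⟨μ, hμ⟩
  rw [IsWeight, iSup_congr h0, iSup_bot] at hw
  exact bot_ne_top hw

end Ramond

end

/-! ### The two halves of the classification -/

theorem lemma3p3 :
    (∀ (lam : ℂ) (V : Type u) [AddCommGroup V] [Module ℂ V] [Ramond.SuperSpace V]
      (σ : Ramond.SuperRep Ramond.tSub V), σ.IsSimple →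
        Ramond.IsAssoc (Ramond.Gamma lam σ) ∧ Ramond.IsWeight (Ramond.Gamma lam σ) ∧
          (Ramond.Gamma lam σ).IsSimple) ∧
    (∀ (M : Type v) [AddCommGroup M] [Module ℂ M] [Ramond.SuperSpace M]
      (ρ : Ramond.SuperRep Ramond.STilde M), Ramond.IsAssoc ρ → Ramond.IsWeight ρ → ρ.IsSimple →
        ∃ lam ∈ Ramond.support ρ, ∃ (V : Type v) (_ : AddCommGroup V) (_ : Module ℂ V)
          (_ : Ramond.SuperSpace V) (σ : Ramond.SuperRep Ramond.tSub V),
          σ.IsSimple ∧ ρ.Iso (Ramond.Gamma lam σ)) := by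
  refine ⟨fun lam V _ _ _ σ hσ => ⟨Ramond.isAssoc_Gamma lam σ, Ramond.isWeight_Gamma lam σ,
    Ramond.isSimple_Gamma lam σ hσ⟩, fun M _ _ _ ρ hρ hw hs => ?_⟩
  have := hs.1
  -- Any weight will do; the weight hypothesis on `M` enters only here.
  obtain ⟨lam, hlam⟩ := Ramond.exists_mem_support hw
  let e := LinearEquiv.ofBijective (Ramond.fromGamma ρ lam)
    ⟨Ramond.injective_fromGamma hρ lam, Ramond.surjective_fromGamma hρ hs hlam⟩
  have hiso : ρ.Iso (Ramond.Gamma lam (Ramond.xiKerRep hρ lam)) := Ramond.SuperRep.Iso.symm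
    ⟨e, fun i v hv => by
      have h := Ramond.hasParity_fromGamma (ρ := ρ) lam i v hv
      rwa [zero_add] at h,
      Ramond.fromGamma_act hρ lam⟩
  exact ⟨lam, hlam, Ramond.xiKer ρ lam, inferInstance, inferInstance, inferInstance,
    Ramond.xiKerRep hρ lam, Ramond.isSimple_of_Gamma lam _ (hs.of_iso hiso), hiso⟩
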